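/- Let $E=(E^0,E^1,r,s)$ be a finite directed graph (finitely many vertices and edges) without sinks and without sources (every vertex emits an edge and receives an edge) in which every loop has an exit: for every path $\mu=(\mu_1,\dots,\mu_k)$, $k\ge 1$, with $s(\mu)=r(\mu)$ there is a $j$ such that $s(\mu_j)$ emits at least two distinct edges. Let $C^*(E)$ be the universal $C^*$-algebra generated by mutually orthogonal projections $P_v$ ($v\in E^0$) and partial isometries $S_e$ ($e\in E^1$) with $S_e^*S_e=P_{r(e)}$, $S_e^*S_f=0$ for $e\ne f$, $S_eS_e^*\le P_{s(e)}$, and $P_v=\sum_{s(e)=v}S_eS_e^*$ for every vertex $v$ that emits an edge; it is unital with $1=\sum_v P_v$. Let $\mathcal F_E$ be the fixed-point algebra of the gauge action $\gamma_z(S_e)=zS_e$, $\gamma_z(P_v)=P_v$ ($z\in\mathbb C$, $|z|=1$), let $\mathcal D_E$ be the $C^*$-subalgebra generated by the projections $S_\mu S_\mu^*$, where $\mu$ runs over all finite paths (including vertices, with $S_v=P_v$) and $S_\mu=S_{\mu_1}\cdots S_{\mu_k}$, and let $\varphi(x)=\sum_{e\in E^1}S_exS_e^*$, which maps $\mathcal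 D_E$ into itself. Let $\mathfrak A_E$ be the group of all $*$-automorphisms $\alpha$ of $\mathcal D_E$ such that for each $\beta\in\{\alpha,\alpha^{-1}\}$ there is an integer $m\ge 0$ such that $\beta\varphi^m$ commutes with $\varphi$ on $\mathcal D_E$. Let $\operatorname{Aut}(C^*(E),\mathcal F_E,\mathcal D_E)$ be the group of $*$-automorphisms $\alpha$ of $C^*(E)$ with $\alpha(\mathcal D_E)=\mathcal D_E$ and $\alpha(\mathcal F_E)=\mathcal F_E$, and let $\operatorname{Aut}_{\mathcal D_E}(C^*(E))$ be the group of $*$-automorphisms of $C^*(E)$ that fix $\mathcal D_E$ pointwise. Suppose that the center of $\mathcal F_E$ is trivial, that is, equal to $\mathbb C1$. Then for every $\alpha\in\operatorname{Aut}(C^*(E),\mathcal F_E,\mathcal D_E)$ the restriction $\alpha|_{\mathcal D_E}$ belongs to $\mathfrak A_E$. The map $\operatorname{Res}:\operatorname{Aut}(C^*(E),\mathcal F_E,\mathcal D_E)\to\mathfrak A_E$, $\alpha\mapsto\alpha|_{\mathcal D_E}$, is a group homomorphism with kernel $\operatorname{Aut}_{\mathcal D_E}(C^*(E))$ (in particular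 $\operatorname{Aut}_{\mathcal D_E}(C^*(E))\subseteq\operatorname{Aut}(C^*(E),\mathcal F_E,\mathcal D_E)$), and it induces an injective group homomorphism from the restricted Weyl group $\mathfrak{RW}_E=\operatorname{Aut}(C^*(E),\mathcal F_E,\mathcal D_E)/\operatorname{Aut}_{\mathcal D_E}(C^*(E))$ into $\mathfrak A_E$. -/

import Mathlib

noncomputable section

namespace GraphCStar

universe u v w

/-! ## Directed graphs -/

/-- A directed graph with vertex set `V`, edge set `E`, source map `s` and range map `r`
(loops and multiple edges are allowed). -/
structure DirectedGraph (V : Type u) (E : Type v) where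
  /-- the source of an edge -/
  s : E → V
  /-- the range of an edge -/
  r : E → V

namespace DirectedGraph

variable {V : Type u} {E : Type v} (G : DirectedGraph V E)

/-- A list of edges is a path if the range of each edge is the source of the next one.
Paths of positive length are the nonempty such lists. -/
def IsPath (μ : List E) : Prop := μ.IsChain (fun e f => G.r e = G.s f)

/-- A loop is a path of positive length whose source and range agree. -/
def IsLoop (μ : List E) : Prop :=
  G.IsPath μ ∧ ∃ h : μ ≠ [], G.s (μ.head h) = G.r (μ.getLast h)

/-- A path has an exit if the source of one of its edges emits at least two distinct edges. -/
def HasExit (μ : List E) : Prop :=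
  ∃ e ∈ μ, ∃ f g : E, f ≠ g ∧ G.s f = G.s e ∧ G.s g = G.s e

/-- Every vertex emits an edge. -/
def NoSinks : Prop := ∀ v, ∃ e, G.s e = v

/-- Every vertex receives an edge. -/
def NoSources : Prop := ∀ v, ∃ e, G.r e = v

/-- Every loop has an exit. -/
def EveryLoopHasExit : Prop := ∀ μ, G.IsLoop μ → G.HasExit μ

end DirectedGraph

/-! ## The free unital complex *-algebra on a set of generators -/

/-- The free unital complex `*`-algebra on `X`: noncommutative polynomials in the letters `x`
(encoded as `(x, false)`) and their adjoints (encoded as `(x, true)`). -/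
abbrev FreeStarAlg (X : Type u) : Type u := MonoidAlgebra ℂ (FreeMonoid (X × Bool))

namespace FreeStarAlg

variable {X : Type u}

/-- The adjoint of a word: reverse it and exchange every letter with its adjoint. -/
def starWord (a : FreeMonoid (X × Bool)) : FreeMonoid (X × Bool) :=
  FreeMonoid.ofList ((a.toList.map fun p => (p.1, !p.2)).reverse)

lemma starWord_mul (a b : FreeMonoid (X × Bool)) :
    starWord (a * b) = starWord b * starWord a := by
  simp [starWord]

lemma starWord_starWord (a : FreeMonoid (X × Bool)) : starWord (starWord a) = a := by
  simp [starWord, Function.comp_def]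

/-- The conjugate-linear extension of `starWord`. -/
instance : Star (FreeStarAlg X) where
  star x := x.coeff.sum fun a c => MonoidAlgebra.single (starWord a) (star c)

lemma star_def (x : FreeStarAlg X) :
    star x = x.coeff.sum fun a c => MonoidAlgebra.single (starWord a) (star c) := rfl

lemma star_single (a : FreeMonoid (X × Bool)) (c : ℂ) :
    star (MonoidAlgebra.single a c : FreeStarAlg X) =
      MonoidAlgebra.single (starWord a) (star c) := by
  rw [star_def, MonoidAlgebra.coeff_single, Finsupp.sum_single_index]; simp

lemma star_zero' : star (0 : FreeStarAlg X) = 0 := by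
  simp [star_def]

lemma star_add' (x y : FreeStarAlg X) : star (x + y) = star x + star y := by
  rw [star_def, MonoidAlgebra.coeff_add, Finsupp.sum_add_index'] <;> simp [star_def]

lemma star_mul' (x y : FreeStarAlg X) : star (x * y) = star y * star x := by
  induction x using MonoidAlgebra.induction_linear with
  | zero => simp [star_zero']
  | add x x' hx hx' => simp [add_mul, mul_add, star_add', hx, hx']
  | single a c =>
    induction y using MonoidAlgebra.induction_linear with
    | zero => simp [star_zero']
    | add y y' hy hy' => simp [add_mul, mul_add, star_add', hy, hy']
    | single b d =>
      simp [MonoidAlgebra.single_mul_single, star_single, starWord_mul, mul_comm]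

lemma star_star' (x : FreeStarAlg X) : star (star x) = x := by
  induction x using MonoidAlgebra.induction_linear with
  | zero => simp [star_zero']
  | add x x' hx hx' => simp [star_add', hx, hx']
  | single a c => simp [star_single, starWord_starWord]

instance : StarRing (FreeStarAlg X) where
  star_involutive := star_star'
  star_mul := star_mul'
  star_add := star_add'

instance : StarModule ℂ (FreeStarAlg X) where
  star_smul c x := by
    induction x using MonoidAlgebra.induction_linear with
    | zero => simp
    | add x x' hx hx' => rw [smul_add, star_add, hx, hx', star_add, smul_add]
    | single a d => simp [star_single, MonoidAlgebra.smul_single]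

/-- The generator `x`. -/
def gen (x : X) : FreeStarAlg X := MonoidAlgebra.single (FreeMonoid.of (x, false)) 1

variable {B : Type w} [Ring B] [StarRing B] [Algebra ℂ B] [StarModule ℂ B]

/-- The `*`-homomorphism out of the free `*`-algebra with prescribed values on the generators. -/
def lift (g : X → B) : FreeStarAlg X →⋆ₐ[ℂ] B :=
  let F : FreeStarAlg X →ₐ[ℂ] B := MonoidAlgebra.lift ℂ B (FreeMonoid (X × Bool))
    (FreeMonoid.lift fun p => if p.2 then star (g p.1) else g p.1)
  { F with
    map_star' := by
      intro x
      change F (star x) = star (F x)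
      induction x using MonoidAlgebra.induction_linear with
      | zero => simp
      | add x x' hx hx' => rw [star_add, map_add, hx, hx', map_add, star_add]
      | single a c =>
        rw [star_single]
        simp only [F, MonoidAlgebra.lift_single, star_smul]
        congr 1
        induction a using FreeMonoid.recOn with
        | one => simp [starWord]
        | of_mul p a ih =>
          rw [starWord_mul, map_mul, map_mul, star_mul, ih]
          congr 1
          rcases p with ⟨x, b⟩
          cases b <;> simp [starWord] }

lemma lift_gen (g : X → B) (x : X) : lift g (gen x) = g x := by
  change MonoidAlgebra.lift ℂ B (FreeMonoid (X × Bool)) _ (gen x) = _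
  simp [gen]

end FreeStarAlg

lemma seminorm_eq_of_sub {X : Type w} (p : Seminorm ℂ (FreeStarAlg X)) {a b} (h : p (a - b) = 0) : p a = p b := by
  refine le_antisymm ?_ ?_
  · have := map_add_le_add p (a - b) b
    simpa [h] using this
  · have := map_sub_le_add p a (a - b)
    simpa [h] using this

/-! ## Cuntz-Krieger families -/

variable {V : Type u} {E : Type v} [Fintype V] [Fintype E]

open Classical in
/-- A Cuntz-Krieger family for the finite graph `G` in a unital `*`-ring `B`: mutually orthogonal
projections `P v` with sum `1`, and elements `S e` subject to the graph algebra relations.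
The relation `S e * star (S e) ≤ P (s e)` between projections is written as
`P (s e) * (S e * star (S e)) = S e * star (S e)`. -/
structure CKFamily (G : DirectedGraph V E) (B : Type w) [Ring B] [StarRing B] where
  P : V → B
  S : E → B
  star_P : ∀ v, star (P v) = P v
  P_mul_P : ∀ v, P v * P v = P v
  P_orth : ∀ v w, v ≠ w → P v * P w = 0
  sum_P : ∑ v, P v = 1
  star_S_mul_S : ∀ e, star (S e) * S e = P (G.r e)
  S_orth : ∀ e f, e ≠ f → star (S e) * S f = 0
  range_le : ∀ e, P (G.s e) * (S e * star (S e)) = S e * star (S e)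
  sum_range : ∀ v, (∃ e, G.s e = v) →
    P v = ∑ e with G.s e = v, S e * star (S e)

/-- The generator of the free `*`-algebra belonging to a vertex. -/
def pGen (V : Type u) (E : Type v) (x : V) : FreeStarAlg (V ⊕ E) := FreeStarAlg.gen (Sum.inl x)

/-- The generator of the free `*`-algebra belonging to an edge. -/
def sGen (V : Type u) (E : Type v) (e : E) : FreeStarAlg (V ⊕ E) := FreeStarAlg.gen (Sum.inr e)

open Classical in
/-- The defining relations of the graph algebra, between elements of the free `*`-algebra. -/
inductive Rel (G : DirectedGraph V E) : FreeStarAlg (V ⊕ E) → FreeStarAlg (V ⊕ E) → Prop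
  | star_P (v : V) : Rel G (star (pGen V E v)) (pGen V E v)
  | P_mul_P (v : V) : Rel G (pGen V E v * pGen V E v) (pGen V E v)
  | P_orth (v w : V) (h : v ≠ w) : Rel G (pGen V E v * pGen V E w) 0
  | sum_P : Rel G (∑ v, pGen V E v) 1
  | star_S_mul_S (e : E) : Rel G (star (sGen V E e) * sGen V E e) (pGen V E (G.r e))
  | S_orth (e f : E) (h : e ≠ f) : Rel G (star (sGen V E e) * sGen V E f) 0
  | range_le (e : E) :
      Rel G (pGen V E (G.s e) * (sGen V E e * star (sGen V E e)))
        (sGen V E e * star (sGen V E e))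
  | sum_range (v : V) (h : ∃ e, G.s e = v) :
      Rel G (pGen V E v)
        (∑ e with G.s e = v, sGen V E e * star (sGen V E e))

/-! ## The universal C*-algebra of a finite graph -/

/-- The C*-seminorms on the free `*`-algebra that vanish on the defining relations. -/
def admissible (G : DirectedGraph V E) : Set (Seminorm ℂ (FreeStarAlg (V ⊕ E))) :=
  {p | (∀ x y, p (x * y) ≤ p x * p y) ∧ (∀ x, p (star x * x) = p x ^ 2) ∧
    ∀ a b, Rel G a b → p (a - b) = 0}


section Bounds

variable {G : DirectedGraph V E} {p : Seminorm ℂ (FreeStarAlg (V ⊕ E))}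

lemma admissible.le_one_of_sq {x : ℝ} (h : x ^ 2 ≤ x) : x ≤ 1 := by nlinarith

lemma admissible.star_le (hp : p ∈ admissible G) (x) : p x ≤ p (star x) := by
  by_cases h : p x = 0
  · rw [h]; exact apply_nonneg p _
  · have h1 : 0 < p x := lt_of_le_of_ne (apply_nonneg p _) (Ne.symm h)
    have h2 := hp.1 (star x) x
    rw [hp.2.1, sq] at h2
    exact le_of_mul_le_mul_right h2 h1

lemma admissible.star_eq (hp : p ∈ admissible G) (x) : p (star x) = p x :=
  le_antisymm (by simpa using admissible.star_le hp (star x)) (admissible.star_le hp x)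

lemma admissible.one_le (hp : p ∈ admissible G) : p 1 ≤ 1 := by
  apply admissible.le_one_of_sq
  rw [← hp.2.1]; simp

lemma admissible.pGen_le (hp : p ∈ admissible G) (v : V) : p (pGen V E v) ≤ 1 := by
  apply admissible.le_one_of_sq
  have h1 : p (star (pGen V E v) * pGen V E v) = p (pGen V E v * pGen V E v) := by
    apply seminorm_eq_of_sub p
    rw [← sub_mul]
    refine le_antisymm ((hp.1 _ _).trans ?_) (apply_nonneg p _)
    rw [hp.2.2 _ _ (Rel.star_P v), zero_mul]
  rw [← hp.2.1, h1, seminorm_eq_of_sub p (hp.2.2 _ _ (Rel.P_mul_P v))]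

lemma admissible.sGen_le (hp : p ∈ admissible G) (e : E) : p (sGen V E e) ≤ 1 := by
  have h := hp.2.1 (sGen V E e)
  rw [seminorm_eq_of_sub p (hp.2.2 _ _ (Rel.star_S_mul_S e))] at h
  have := admissible.pGen_le hp (G.r e)
  nlinarith [apply_nonneg p (sGen V E e)]

lemma admissible.letter_le (hp : p ∈ admissible G) (l : (V ⊕ E) × Bool) :
    p (MonoidAlgebra.single (FreeMonoid.of l) 1) ≤ 1 := by
  obtain ⟨x, b⟩ := l
  have h : p (FreeStarAlg.gen x) ≤ 1 := by
    cases x with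
    | inl v => exact admissible.pGen_le hp v
    | inr e => exact admissible.sGen_le hp e
  cases b with
  | false => exact h
  | true =>
    rw [← admissible.star_eq hp] at h
    simpa [FreeStarAlg.gen, FreeStarAlg.star_single, FreeStarAlg.starWord] using h

lemma admissible.word_le (hp : p ∈ admissible G) (a : FreeMonoid ((V ⊕ E) × Bool)) :
    p (MonoidAlgebra.single a 1) ≤ 1 := by
  induction a using FreeMonoid.recOn with
  | one => simpa [MonoidAlgebra.one_def] using admissible.one_le hp
  | of_mul l a ih =>
    have h : (MonoidAlgebra.single (FreeMonoid.of l * a) 1 : FreeStarAlg (V ⊕ E)) =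
        MonoidAlgebra.single (FreeMonoid.of l) 1 * MonoidAlgebra.single a 1 := by
      simp [MonoidAlgebra.single_mul_single]
    rw [h]
    exact (hp.1 _ _).trans (mul_le_one₀ (admissible.letter_le hp l) (apply_nonneg p _) ih)

/-- The admissible seminorms are pointwise bounded. -/
lemma admissible.bddAbove (G : DirectedGraph V E) (x : FreeStarAlg (V ⊕ E)) :
    BddAbove (Set.range fun p : admissible G => p.1 x) := by
  induction x using MonoidAlgebra.induction_linear with
  | zero => exact ⟨0, by rintro _ ⟨p, rfl⟩; simp⟩
  | add x y hx hy =>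
    obtain ⟨C, hC⟩ := hx
    obtain ⟨D, hD⟩ := hy
    refine ⟨C + D, ?_⟩
    rintro _ ⟨p, rfl⟩
    exact (map_add_le_add p.1 x y).trans (add_le_add (hC ⟨p, rfl⟩) (hD ⟨p, rfl⟩))
  | single a c =>
    refine ⟨‖c‖, ?_⟩
    rintro _ ⟨p, rfl⟩
    have h : (MonoidAlgebra.single a c : FreeStarAlg (V ⊕ E)) =
        c • MonoidAlgebra.single a 1 := by simp [MonoidAlgebra.smul_single]
    simp only [h, map_smul_eq_mul]
    exact mul_le_of_le_one_right (norm_nonneg c) (admissible.word_le p.2 a)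

end Bounds

lemma zero_mem_admissible (G : DirectedGraph V E) : (0 : Seminorm ℂ _) ∈ admissible G :=
  ⟨by simp, by simp, by simp⟩

instance (G : DirectedGraph V E) : Nonempty (admissible G) := ⟨⟨0, zero_mem_admissible G⟩⟩

/-- The largest C*-seminorm that vanishes on the defining relations. -/
def maxNorm (G : DirectedGraph V E) (x : FreeStarAlg (V ⊕ E)) : ℝ :=
  ⨆ p : admissible G, p.1 x

section MaxNorm

variable (G : DirectedGraph V E)

lemma le_maxNorm {p} (hp : p ∈ admissible G) (x) : p x ≤ maxNorm G x :=
  le_ciSup (admissible.bddAbove G x) ⟨p, hp⟩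

lemma maxNorm_nonneg (x) : 0 ≤ maxNorm G x := le_maxNorm G (zero_mem_admissible G) x

lemma maxNorm_le {x C} (h : ∀ p ∈ admissible G, p x ≤ C) : maxNorm G x ≤ C :=
  ciSup_le fun p => h p.1 p.2

lemma maxNorm_zero : maxNorm G 0 = 0 :=
  le_antisymm (maxNorm_le G fun p _ => by simp) (maxNorm_nonneg G 0)

lemma maxNorm_add (x y) : maxNorm G (x + y) ≤ maxNorm G x + maxNorm G y :=
  maxNorm_le G fun p hp =>
    (map_add_le_add p x y).trans (add_le_add (le_maxNorm G hp x) (le_maxNorm G hp y))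

lemma maxNorm_neg (x) : maxNorm G (-x) = maxNorm G x := by
  simp [maxNorm]

lemma maxNorm_mul (x y) : maxNorm G (x * y) ≤ maxNorm G x * maxNorm G y :=
  maxNorm_le G fun p hp => (hp.1 x y).trans
    (mul_le_mul (le_maxNorm G hp x) (le_maxNorm G hp y) (apply_nonneg p _) (maxNorm_nonneg G x))

lemma maxNorm_smul (c : ℂ) (x) : maxNorm G (c • x) ≤ ‖c‖ * maxNorm G x :=
  maxNorm_le G fun p hp => by
    rw [map_smul_eq_mul]
    exact mul_le_mul_of_nonneg_left (le_maxNorm G hp x) (norm_nonneg c)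

lemma maxNorm_star (x) : maxNorm G (star x) = maxNorm G x := by
  unfold maxNorm
  congr 1
  funext p
  exact admissible.star_eq p.2 x

lemma maxNorm_sq_le (x) : maxNorm G x * maxNorm G x ≤ maxNorm G (star x * x) := by
  have h : maxNorm G x ≤ √(maxNorm G (star x * x)) := maxNorm_le G fun p hp => by
    apply Real.le_sqrt_of_sq_le
    rw [← hp.2.1]
    exact le_maxNorm G hp _
  calc _ ≤ √(maxNorm G (star x * x)) * √(maxNorm G (star x * x)) :=
        mul_self_le_mul_self (maxNorm_nonneg G x) h
    _ = _ := Real.mul_self_sqrt (maxNorm_nonneg G _)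

lemma maxNorm_rel {a b} (h : Rel G a b) : maxNorm G (a - b) = 0 :=
  le_antisymm (maxNorm_le G fun _ hp => (hp.2.2 a b h).le) (maxNorm_nonneg G _)

end MaxNorm

/-- The free `*`-algebra, equipped with the largest C*-seminorm that vanishes on the defining
relations of the graph algebra of `G`. -/
def PreGraphAlg (_G : DirectedGraph V E) : Type (max u v) := FreeStarAlg (V ⊕ E)

section Pre

variable (G : DirectedGraph V E)

instance : Ring (PreGraphAlg G) := inferInstanceAs (Ring (FreeStarAlg (V ⊕ E)))
instance : Algebra ℂ (PreGraphAlg G) := inferInstanceAs (Algebra ℂ (FreeStarAlg (V ⊕ E)))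
instance : StarRing (PreGraphAlg G) := inferInstanceAs (StarRing (FreeStarAlg (V ⊕ E)))
instance : StarModule ℂ (PreGraphAlg G) := inferInstanceAs (StarModule ℂ (FreeStarAlg (V ⊕ E)))

/-- The identity map from the free `*`-algebra. -/
def toPre : FreeStarAlg (V ⊕ E) →⋆ₐ[ℂ] PreGraphAlg G := StarAlgHom.id ℂ (FreeStarAlg (V ⊕ E))

instance : SeminormedRing (PreGraphAlg G) where
  __ := AddGroupSeminorm.toSeminormedAddCommGroup
    ({ toFun := maxNorm G
       map_zero' := maxNorm_zero G
       add_le' := maxNorm_add G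
       neg' := maxNorm_neg G } : AddGroupSeminorm (PreGraphAlg G))
  __ := (inferInstance : Ring (PreGraphAlg G))
  norm_mul_le := maxNorm_mul G

lemma norm_toPre (x) : ‖toPre G x‖ = maxNorm G x := rfl

lemma norm_pre (x : PreGraphAlg G) : ‖x‖ = maxNorm G x := rfl

instance : NormedAlgebra ℂ (PreGraphAlg G) where
  norm_smul_le := maxNorm_smul G

instance : NormedStarGroup (PreGraphAlg G) where
  norm_star_le x := (maxNorm_star G x).le

end Pre

open UniformSpace

/-- The C*-algebra `C*(G)` of the finite graph `G`: the universal C*-algebra generated by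
a Cuntz-Krieger family, as the Hausdorff completion of the free `*`-algebra in
the largest C*-seminorm that vanishes on the defining relations. (The graph being finite,
this algebra is unital, with unit the sum of the vertex projections.) -/
def GraphAlg (G : DirectedGraph V E) : Type (max u v) := Completion (PreGraphAlg G)

section Universal

variable (G : DirectedGraph V E)

instance : NormedRing (GraphAlg G) := inferInstanceAs (NormedRing (Completion (PreGraphAlg G)))
instance : CompleteSpace (GraphAlg G) :=
  inferInstanceAs (CompleteSpace (Completion (PreGraphAlg G)))
instance : Algebra ℂ (GraphAlg G) := inferInstanceAs (Algebra ℂ (Completion (PreGraphAlg G)))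
instance : NormedSpace ℂ (GraphAlg G) :=
  inferInstanceAs (NormedSpace ℂ (Completion (PreGraphAlg G)))
instance : NormedAlgebra ℂ (GraphAlg G) where
  norm_smul_le := norm_smul_le

/-- The canonical homomorphism into the completion. -/
def toGraphAlg : PreGraphAlg G →+* GraphAlg G := Completion.coeRingHom

lemma norm_toGraphAlg (x) : ‖toGraphAlg G x‖ = ‖x‖ := Completion.norm_coe x

lemma denseRange_toGraphAlg : DenseRange (toGraphAlg G) := Completion.denseRange_coe

lemma toGraphAlg_smul (c : ℂ) (x) : toGraphAlg G (c • x) = c • toGraphAlg G x :=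
  Completion.coe_smul c x

instance : Star (GraphAlg G) where
  star := Completion.map (star : PreGraphAlg G → PreGraphAlg G)

lemma star_toGraphAlg (x) : star (toGraphAlg G x) = toGraphAlg G (star x) :=
  Completion.map_coe (starₗᵢ ℂ : PreGraphAlg G ≃ₗᵢ⋆[ℂ] PreGraphAlg G).isometry.uniformContinuous x

lemma continuous_star_graphAlg : Continuous (star : GraphAlg G → GraphAlg G) :=
  Completion.continuous_map

instance : StarRing (GraphAlg G) where
  star_involutive x := by
    have h := continuous_star_graphAlg G
    refine (denseRange_toGraphAlg G).induction_on
      (p := fun x => star (star x) = x) x (isClosed_eq (h.comp h) continuous_id) fun a => ?_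
    simp only [star_toGraphAlg, star_star]
  star_mul x y := by
    have h := continuous_star_graphAlg G
    refine (denseRange_toGraphAlg G).induction_on₂
      (p := fun x y => star (x * y) = star y * star x)
      (isClosed_eq (h.comp continuous_mul)
        ((h.comp continuous_snd).mul (h.comp continuous_fst))) (fun a b => ?_) x y
    simp only [star_toGraphAlg, ← map_mul, star_mul]
  star_add x y := by
    have h := continuous_star_graphAlg G
    refine (denseRange_toGraphAlg G).induction_on₂
      (p := fun x y => star (x + y) = star x + star y)
      (isClosed_eq (h.comp continuous_add)
        ((h.comp continuous_fst).add (h.comp continuous_snd))) (fun a b => ?_) x y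
    simp only [star_toGraphAlg, ← map_add, star_add]

instance : StarModule ℂ (GraphAlg G) where
  star_smul c x := by
    have h := continuous_star_graphAlg G
    refine (denseRange_toGraphAlg G).induction_on
      (p := fun x => star (c • x) = star c • star x) x
      (isClosed_eq (h.comp (continuous_const_smul c)) (h.const_smul (star c))) fun a => ?_
    simp only [star_toGraphAlg, ← toGraphAlg_smul, star_smul]

instance : CStarRing (GraphAlg G) where
  norm_mul_self_le x := by
    have h := continuous_star_graphAlg G
    refine (denseRange_toGraphAlg G).induction_on
      (p := fun x => ‖x‖ * ‖x‖ ≤ ‖star x * x‖) x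
      (isClosed_le (continuous_norm.mul continuous_norm)
        (continuous_norm.comp (h.mul continuous_id))) fun a => ?_
    simp only [star_toGraphAlg, ← map_mul, norm_toGraphAlg]
    exact maxNorm_sq_le G a

instance : CStarAlgebra (GraphAlg G) where

/-- The canonical `*`-homomorphism from the free `*`-algebra into the graph algebra. -/
def can : FreeStarAlg (V ⊕ E) →⋆ₐ[ℂ] GraphAlg G where
  __ := (toGraphAlg G).comp (toPre G : FreeStarAlg (V ⊕ E) →+* PreGraphAlg G)
  commutes' c := by
    change toGraphAlg G (algebraMap ℂ _ c) = algebraMap ℂ _ c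
    rw [Algebra.algebraMap_eq_smul_one, toGraphAlg_smul, map_one,
      Algebra.algebraMap_eq_smul_one]
  map_star' x := by
    change toGraphAlg G (star (toPre G x)) = star (toGraphAlg G (toPre G x))
    rw [star_toGraphAlg]

lemma norm_can (x) : ‖can G x‖ = maxNorm G x := norm_toGraphAlg G (toPre G x)

lemma denseRange_can : DenseRange (can G) := denseRange_toGraphAlg G

lemma can_rel {a b} (h : Rel G a b) : can G a = can G b := by
  rw [← sub_eq_zero, ← map_sub, ← norm_eq_zero, norm_can, maxNorm_rel G h]

/-- The universal Cuntz-Krieger family, generating the graph algebra. -/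
def univFamily : CKFamily G (GraphAlg G) where
  P v := can G (pGen V E v)
  S e := can G (sGen V E e)
  star_P v := by rw [← map_star]; exact can_rel G (.star_P v)
  P_mul_P v := by rw [← map_mul]; exact can_rel G (.P_mul_P v)
  P_orth v w h := by rw [← map_mul, can_rel G (.P_orth v w h), map_zero]
  sum_P := by rw [← map_sum, can_rel G .sum_P, map_one]
  star_S_mul_S e := by rw [← map_star, ← map_mul]; exact can_rel G (.star_S_mul_S e)
  S_orth e f h := by rw [← map_star, ← map_mul, can_rel G (.S_orth e f h), map_zero]
  range_le e := by
    simp only [← map_star, ← map_mul]; exact can_rel G (.range_le e)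
  sum_range v h := by
    simp only [← map_star, ← map_mul, ← map_sum]; exact can_rel G (.sum_range v h)

/-- The vertex projections of the graph algebra. -/
def PV (v : V) : GraphAlg G := (univFamily G).P v

/-- The generating partial isometries of the graph algebra. -/
def SE (e : E) : GraphAlg G := (univFamily G).S e

variable {G} {B : Type w} [CStarAlgebra B]

/-- The seminorm on the free `*`-algebra given by a Cuntz-Krieger family in a C*-algebra. -/
def CKFamily.seminorm (F : CKFamily G B) : Seminorm ℂ (FreeStarAlg (V ⊕ E)) :=
  (normSeminorm ℂ B).comp
    (FreeStarAlg.lift (Sum.elim F.P F.S) : FreeStarAlg (V ⊕ E) →ₐ[ℂ] B).toLinearMap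

lemma CKFamily.seminorm_apply (F : CKFamily G B) (x) :
    F.seminorm x = ‖FreeStarAlg.lift (Sum.elim F.P F.S) x‖ := rfl

lemma CKFamily.lift_rel (F : CKFamily G B) {a b} (h : Rel G a b) :
    FreeStarAlg.lift (Sum.elim F.P F.S) a = FreeStarAlg.lift (Sum.elim F.P F.S) b := by
  have hP (v : V) : FreeStarAlg.lift (Sum.elim F.P F.S) (pGen V E v) = F.P v :=
    FreeStarAlg.lift_gen _ _
  have hS (e : E) : FreeStarAlg.lift (Sum.elim F.P F.S) (sGen V E e) = F.S e :=
    FreeStarAlg.lift_gen _ _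
  cases h with
  | star_P v => rw [map_star, hP, F.star_P]
  | P_mul_P v => rw [map_mul, hP, F.P_mul_P]
  | P_orth v w h => rw [map_mul, hP, hP, F.P_orth v w h, map_zero]
  | sum_P => simp only [map_sum, hP, F.sum_P, map_one]
  | star_S_mul_S e => rw [map_mul, map_star, hP, hS, F.star_S_mul_S]
  | S_orth e f h => rw [map_mul, map_star, hS, hS, F.S_orth e f h, map_zero]
  | range_le e => simp only [map_mul, map_star, hP, hS, F.range_le]
  | sum_range v h => simp only [map_sum, map_mul, map_star, hP, hS, F.sum_range v h]

lemma CKFamily.seminorm_mem (F : CKFamily G B) : F.seminorm ∈ admissible G := by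
  refine ⟨fun x y => ?_, fun x => ?_, fun a b h => ?_⟩
  · simp only [seminorm_apply, map_mul]; exact norm_mul_le _ _
  · simp only [seminorm_apply, map_mul, map_star, CStarRing.norm_star_mul_self, sq]
  · simp only [seminorm_apply, map_sub, F.lift_rel h, sub_self, norm_zero]

/-- The homomorphism out of the pre-completion determined by a Cuntz-Krieger family. -/
def CKFamily.preLift (F : CKFamily G B) : PreGraphAlg G →+* B :=
  (FreeStarAlg.lift (Sum.elim F.P F.S) : FreeStarAlg (V ⊕ E) →+* B)

lemma CKFamily.continuous_preLift (F : CKFamily G B) : Continuous F.preLift :=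
  AddMonoidHomClass.continuous_of_bound F.preLift 1 fun x => by
    rw [one_mul]; exact le_maxNorm G F.seminorm_mem x

/-- The universal property: a Cuntz-Krieger family in a unital C*-algebra (in any universe)
induces a unital `*`-homomorphism from the graph algebra. -/
def CKFamily.lift (F : CKFamily G B) : GraphAlg G →⋆ₐ[ℂ] B :=
  let φ : GraphAlg G →+* B := Completion.extensionHom F.preLift F.continuous_preLift
  have hc : Continuous φ := Completion.continuous_extension
  have hφ (x) : φ (can G x) = FreeStarAlg.lift (Sum.elim F.P F.S) x :=
    Completion.extensionHom_coe F.preLift F.continuous_preLift (toPre G x)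
  { φ with
    commutes' := fun c => by
      change φ (algebraMap ℂ _ c) = _
      rw [← AlgHomClass.commutes (can G) c, hφ, AlgHomClass.commutes]
    map_star' := fun x => by
      change φ (star x) = star (φ x)
      refine (denseRange_can G).induction_on (p := fun x => φ (star x) = star (φ x)) x
        (isClosed_eq (hc.comp continuous_star) (continuous_star.comp hc)) fun a => ?_
      rw [← map_star, hφ, hφ, map_star] }

lemma CKFamily.lift_can (F : CKFamily G B) (x) :
    F.lift (can G x) = FreeStarAlg.lift (Sum.elim F.P F.S) x :=
  Completion.extensionHom_coe F.preLift F.continuous_preLift (toPre G x)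

lemma CKFamily.lift_P (F : CKFamily G B) (v : V) : F.lift (PV G v) = F.P v :=
  (F.lift_can _).trans (FreeStarAlg.lift_gen _ _)

lemma CKFamily.lift_S (F : CKFamily G B) (e : E) : F.lift (SE G e) = F.S e :=
  (F.lift_can _).trans (FreeStarAlg.lift_gen _ _)

end Universal

/-! ## The gauge action, the core and the diagonal -/

section Subalgebras

variable (G : DirectedGraph V E)

lemma gauge_aux (z : Circle) : star (z : ℂ) * z = 1 := by
  simp [← Circle.coe_inv_eq_conj]

lemma gauge_aux' (z : Circle) : (z : ℂ) * star (z : ℂ) = 1 := by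
  rw [mul_comm, gauge_aux]

/-- The Cuntz-Krieger family `(P v, z • S e)` for `z` in the unit circle. -/
def gaugeFamily (z : Circle) : CKFamily G (GraphAlg G) where
  P v := PV G v
  S e := (z : ℂ) • SE G e
  star_P := (univFamily G).star_P
  P_mul_P := (univFamily G).P_mul_P
  P_orth := (univFamily G).P_orth
  sum_P := (univFamily G).sum_P
  star_S_mul_S e := by
    rw [star_smul, smul_mul_smul_comm, gauge_aux, one_smul]
    exact (univFamily G).star_S_mul_S e
  S_orth e f h := by
    rw [star_smul, smul_mul_smul_comm, gauge_aux, one_smul]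
    exact (univFamily G).S_orth e f h
  range_le e := by
    rw [star_smul, smul_mul_smul_comm, gauge_aux', one_smul]
    exact (univFamily G).range_le e
  sum_range v h := by
    simp only [star_smul, smul_mul_smul_comm, gauge_aux', one_smul]
    exact (univFamily G).sum_range v h

/-- The gauge action `γ z`: the endomorphism with `γ z (P v) = P v` and `γ z (S e) = z S e`. -/
def gauge (z : Circle) : GraphAlg G →⋆ₐ[ℂ] GraphAlg G := (gaugeFamily G z).lift

/-- The core AF-subalgebra `F_G`: the fixed-point algebra of the gauge action. -/
def core : StarSubalgebra ℂ (GraphAlg G) where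
  carrier := {x | ∀ z : Circle, gauge G z x = x}
  mul_mem' hx hy z := by rw [map_mul, hx z, hy z]
  add_mem' hx hy z := by rw [map_add, hx z, hy z]
  algebraMap_mem' c z := AlgHomClass.commutes _ c
  star_mem' hx z := by rw [map_star, hx z]

/-- `S_μ`, the product of the generators along a list of edges. -/
def SPath (μ : List E) : GraphAlg G := (μ.map (SE G)).prod

/-- The projections `P_μ = S_μ S_μ^*`, for all paths `μ`, including the paths of length zero,
for which `P_μ` is a vertex projection. -/
def pathProjections : Set (GraphAlg G) :=
  {x | (∃ v, x = PV G v) ∨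
    ∃ μ : List E, μ ≠ [] ∧ G.IsPath μ ∧ x = SPath G μ * star (SPath G μ)}

/-- The diagonal subalgebra `D_G`: the C*-subalgebra generated by the path projections. -/
def diag : StarSubalgebra ℂ (GraphAlg G) :=
  (StarAlgebra.adjoin ℂ (pathProjections G)).topologicalClosure

/-- The shift `φ(x) = ∑ S_e x S_e^*` on the graph algebra. -/
def shift (x : GraphAlg G) : GraphAlg G := ∑ e, SE G e * x * star (SE G e)

variable {G}

lemma star_PV (v : V) : star (PV G v) = PV G v := (univFamily G).star_P v

lemma PV_mul_PV (v w : V) (h : v ≠ w) : PV G v * PV G w = 0 := (univFamily G).P_orth v w h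

lemma sum_PV : ∑ v, PV G v = 1 := (univFamily G).sum_P

lemma star_SE_mul_SE (e : E) : star (SE G e) * SE G e = PV G (G.r e) :=
  (univFamily G).star_S_mul_S e

lemma star_SE_mul_SE_of_ne (e f : E) (h : e ≠ f) : star (SE G e) * SE G f = 0 :=
  (univFamily G).S_orth e f h

lemma PV_mul_range (e : E) :
    PV G (G.s e) * (SE G e * star (SE G e)) = SE G e * star (SE G e) :=
  (univFamily G).range_le e

lemma PV_mul_SE (v : V) (e : E) (h : G.s e ≠ v) : PV G v * SE G e = 0 := by
  have h1 : PV G v * (SE G e * star (SE G e)) = 0 := by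
    rw [← PV_mul_range, ← mul_assoc, PV_mul_PV _ _ (Ne.symm h), zero_mul]
  rw [← norm_eq_zero, ← mul_self_eq_zero, ← CStarRing.norm_self_mul_star, norm_eq_zero,
    star_mul, mul_assoc, ← mul_assoc (SE G e), ← mul_assoc, h1, zero_mul]

lemma PV_source_mul_SE (e : E) : PV G (G.s e) * SE G e = SE G e := by
  calc PV G (G.s e) * SE G e = (∑ v, PV G v) * SE G e := by
        rw [Finset.sum_mul, Finset.sum_eq_single_of_mem (G.s e) (Finset.mem_univ _)]
        exact fun v _ hv => PV_mul_SE v e (Ne.symm hv)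
    _ = SE G e := by rw [sum_PV, one_mul]

lemma SE_mul_PV (v : V) (e : E) (h : G.r e ≠ v) : SE G e * PV G v = 0 := by
  rw [← norm_eq_zero, ← mul_self_eq_zero, ← CStarRing.norm_star_mul_self, norm_eq_zero,
    star_mul, mul_assoc, ← mul_assoc (star (SE G e)), star_SE_mul_SE, PV_mul_PV _ _ h, mul_zero]

lemma SE_mul_PV_range (e : E) : SE G e * PV G (G.r e) = SE G e := by
  calc SE G e * PV G (G.r e) = SE G e * ∑ v, PV G v := by
        rw [Finset.mul_sum, Finset.sum_eq_single_of_mem (G.r e) (Finset.mem_univ _)]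
        exact fun v _ hv => SE_mul_PV v e (Ne.symm hv)
    _ = SE G e := by rw [sum_PV, mul_one]

lemma SE_mul_SE_of_ne (e f : E) (h : G.r e ≠ G.s f) : SE G e * SE G f = 0 := by
  rw [← PV_source_mul_SE f, ← mul_assoc, SE_mul_PV _ _ h, zero_mul]

lemma SPath_cons (e : E) (μ : List E) : SPath G (e :: μ) = SE G e * SPath G μ := by
  simp [SPath]

lemma commute_PV_pathProjections (v : V) {x} (hx : x ∈ pathProjections G) :
    Commute (PV G v) x := by
  rcases hx with ⟨w, rfl⟩ | ⟨μ, hμ, -, rfl⟩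
  · by_cases h : v = w
    · subst h; exact Commute.refl _
    · rw [Commute, SemiconjBy, PV_mul_PV _ _ h, PV_mul_PV _ _ (Ne.symm h)]
  · obtain ⟨e, μ, rfl⟩ := List.exists_cons_of_ne_nil hμ
    set y := SPath G (e :: μ) * star (SPath G (e :: μ)) with hy
    have hs : star y = y := by rw [hy, star_mul, star_star]
    by_cases h : G.s e = v
    · have h1 : PV G v * y = y := by
        rw [hy, SPath_cons, ← h, ← mul_assoc, ← mul_assoc, PV_source_mul_SE]
      have h2 := congrArg star h1
      rw [star_mul, hs, star_PV] at h2
      rw [Commute, SemiconjBy, h1, h2]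
    · have h1 : PV G v * y = 0 := by
        rw [hy, SPath_cons, ← mul_assoc, ← mul_assoc, PV_mul_SE _ _ h, zero_mul, zero_mul]
      have h2 := congrArg star h1
      rw [star_mul, hs, star_PV, star_zero] at h2
      rw [Commute, SemiconjBy, h1, h2]

lemma pathProjections_subset : pathProjections G ⊆ diag G := fun _ hx =>
  StarSubalgebra.le_topologicalClosure _ (StarAlgebra.subset_adjoin ℂ _ hx)

lemma range_mem_diag (e : E) : SE G e * star (SE G e) ∈ diag G :=
  pathProjections_subset (Or.inr ⟨[e], by simp, by simp [DirectedGraph.IsPath],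
    by simp [SPath]⟩)

lemma shift_mem_of_pathProjections {x} (hx : x ∈ pathProjections G) : shift G x ∈ diag G := by
  refine sum_mem fun e _ => ?_
  rcases hx with ⟨v, rfl⟩ | ⟨μ, hμ, hp, rfl⟩
  · by_cases h : G.r e = v
    · rw [← h, SE_mul_PV_range]; exact range_mem_diag e
    · rw [SE_mul_PV _ _ h, zero_mul]; exact zero_mem _
  · obtain ⟨f, μ, rfl⟩ := List.exists_cons_of_ne_nil hμ
    have h1 : SE G e * (SPath G (f :: μ) * star (SPath G (f :: μ))) * star (SE G e) =
        SPath G (e :: f :: μ) * star (SPath G (e :: f :: μ)) := by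
      rw [SPath_cons e, star_mul]; simp only [mul_assoc]
    rw [h1]
    by_cases h : G.r e = G.s f
    · refine pathProjections_subset (Or.inr ⟨e :: f :: μ, by simp, ?_, rfl⟩)
      exact List.isChain_cons_cons.2 ⟨h, hp⟩
    · rw [SPath_cons, SPath_cons, ← mul_assoc, SE_mul_SE_of_ne _ _ h, zero_mul, zero_mul]
      exact zero_mem _

lemma shift_add (x y : GraphAlg G) : shift G (x + y) = shift G x + shift G y := by
  simp [shift, mul_add, add_mul, Finset.sum_add_distrib]

lemma shift_star (x : GraphAlg G) : shift G (star x) = star (shift G x) := by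
  simp [shift, mul_assoc]

lemma shift_mul (x y : GraphAlg G) (hx : ∀ v, Commute (PV G v) x) :
    shift G (x * y) = shift G x * shift G y := by
  rw [shift, shift, shift, Finset.sum_mul]
  refine Finset.sum_congr rfl fun e _ => ?_
  rw [Finset.mul_sum, Finset.sum_eq_single_of_mem e (Finset.mem_univ _)]
  · calc SE G e * (x * y) * star (SE G e)
        = SE G e * (PV G (G.r e) * x) * y * star (SE G e) := by
          rw [← mul_assoc (SE G e) (PV G _), SE_mul_PV_range]; simp only [mul_assoc]
      _ = SE G e * (x * (star (SE G e) * SE G e)) * y * star (SE G e) := by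
          rw [(hx (G.r e)).eq, star_SE_mul_SE]
      _ = _ := by simp only [mul_assoc]
  · intro f _ hf
    calc SE G e * x * star (SE G e) * (SE G f * y * star (SE G f))
        = SE G e * x * (star (SE G e) * SE G f) * y * star (SE G f) := by simp only [mul_assoc]
      _ = 0 := by rw [star_SE_mul_SE_of_ne _ _ (Ne.symm hf)]; simp

lemma continuous_shift : Continuous (shift G) := by
  unfold shift; fun_prop

/-- The shift maps the diagonal into itself. -/
lemma shift_mem_diag {x} (hx : x ∈ diag G) : shift G x ∈ diag G := by
  let K : StarSubalgebra ℂ (GraphAlg G) :=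
    { carrier := {x | (∀ v, Commute (PV G v) x) ∧ shift G x ∈ diag G}
      mul_mem' := fun {x y} hx hy => ⟨fun v => (hx.1 v).mul_right (hy.1 v), by
        rw [shift_mul x y hx.1]; exact mul_mem hx.2 hy.2⟩
      add_mem' := fun {x y} hx hy => ⟨fun v => (hx.1 v).add_right (hy.1 v), by
        rw [shift_add]; exact add_mem hx.2 hy.2⟩
      algebraMap_mem' := fun c => ⟨fun v => Algebra.commute_algebraMap_right c _, by
        refine sum_mem fun e _ => ?_
        rw [Algebra.algebraMap_eq_smul_one, mul_smul_comm, mul_one, smul_mul_assoc]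
        exact SMulMemClass.smul_mem c (range_mem_diag e)⟩
      star_mem' := fun {x} hx => ⟨fun v => by
        have := (hx.1 v).star_star; rwa [star_PV] at this, by
        rw [shift_star]; exact star_mem hx.2⟩ }
  have hK : IsClosed (K : Set (GraphAlg G)) := by
    have h1 : IsClosed {x : GraphAlg G | ∀ v, PV G v * x = x * PV G v} := by
      simp only [Set.ofPred_forall]
      exact isClosed_iInter fun v => isClosed_eq (by fun_prop) (by fun_prop)
    exact h1.inter ((StarSubalgebra.isClosed_topologicalClosure _).preimage continuous_shift)
  have hle : diag G ≤ K := StarSubalgebra.topologicalClosure_minimal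
    (StarAlgebra.adjoin_le fun x hx =>
      ⟨fun v => commute_PV_pathProjections v hx, shift_mem_of_pathProjections hx⟩) hK
  exact (hle hx).2

variable (G)

/-- The restriction of the shift to the diagonal. -/
def diagShift (x : diag G) : diag G := ⟨shift G x, shift_mem_diag x.2⟩

end Subalgebras

/-! ## Groups of automorphisms -/

section Automorphisms

variable {A : Type w} [CStarAlgebra A] (B C : StarSubalgebra ℂ A)

/-- `Aut(A, B)`: the automorphisms `α` of `A` with `α(B) = B`. -/
def autPreserving : Subgroup (A ≃⋆ₐ[ℂ] A) where
  carrier := {α | α '' (B : Set A) = B}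
  one_mem' := Set.image_id _
  mul_mem' {α β} hα hβ := by
    change (fun x => α (β x)) '' (B : Set A) = B
    rw [← Set.image_image, hβ, hα]
  inv_mem' {α} hα := by
    change α.symm '' (B : Set A) = B
    conv_lhs => rw [← hα]
    simp [Set.image_image]

/-- `Aut_B(A)`: the automorphisms of `A` that fix `B` pointwise. -/
def autFixing : Subgroup (A ≃⋆ₐ[ℂ] A) where
  carrier := {α | ∀ x ∈ B, α x = x}
  one_mem' _ _ := rfl
  mul_mem' {α β} hα hβ x hx := by rw [StarAlgEquiv.mul_apply, hβ x hx, hα x hx]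
  inv_mem' {α} hα x hx := by
    rw [StarAlgEquiv.aut_inv, StarAlgEquiv.symm_apply_eq, hα x hx]

variable {B}

lemma apply_mem {α : A ≃⋆ₐ[ℂ] A} (hα : α ∈ autPreserving B) {x} (hx : x ∈ B) : α x ∈ B := by
  have : α x ∈ α '' (B : Set A) := ⟨x, hx, rfl⟩
  rwa [show α '' (B : Set A) = B from hα] at this

variable (B)

/-- The restriction homomorphism from `Aut(A, B)` to `Aut(B)`. -/
def restrictAut : autPreserving B →* (B ≃⋆ₐ[ℂ] B) where
  toFun α :=
    { toFun := fun x => ⟨α.1 x, apply_mem α.2 x.2⟩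
      invFun := fun x => ⟨(α⁻¹).1 x, apply_mem (α⁻¹).2 x.2⟩
      left_inv := fun x => Subtype.ext (α.1.symm_apply_apply x)
      right_inv := fun x => Subtype.ext (α.1.apply_symm_apply x)
      map_mul' := fun x y => Subtype.ext (map_mul α.1 (x : A) y)
      map_add' := fun x y => Subtype.ext (map_add α.1 (x : A) y)
      map_star' := fun x => Subtype.ext (map_star α.1 (x : A))
      map_smul' := fun c x => Subtype.ext (map_smul α.1 c (x : A)) }
  map_one' := rfl
  map_mul' _ _ := rfl

/-- `Aut_B(A)` is normal in `Aut(A, B) ∩ Aut(A, C)`. -/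
instance : ((autFixing B).subgroupOf (autPreserving B ⊓ autPreserving C)).Normal where
  conj_mem α hα β := by
    rw [Subgroup.mem_subgroupOf] at hα ⊢
    intro x hx
    have h1 : (β.1)⁻¹ x ∈ B := apply_mem (inv_mem β.2.1) hx
    change β.1 (α.1 ((β.1)⁻¹ x)) = x
    rw [hα _ h1]
    exact β.1.apply_symm_apply x

end Automorphisms

section Weyl

variable (G : DirectedGraph V E)

/-- `Aut(C*(G), F_G, D_G)`: the automorphisms preserving both the diagonal and the core. -/
abbrev autDiagCore : Subgroup (GraphAlg G ≃⋆ₐ[ℂ] GraphAlg G) :=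
  autPreserving (diag G) ⊓ autPreserving (core G)

/-- The restricted Weyl group: the quotient of `Aut(C*(G), F_G, D_G)` by the automorphisms that
fix the diagonal pointwise. -/
abbrev RestrictedWeylGroup : Type (max u v) :=
  autDiagCore G ⧸ (autFixing (diag G)).subgroupOf (autDiagCore G)

variable {G}

/-- Property (P): for some `m`, the map `α φ^m` commutes with the shift `φ` on the diagonal. -/
def EventuallyCommutes (α : diag G ≃⋆ₐ[ℂ] diag G) : Prop :=
  ∃ m : ℕ, Function.Commute (α ∘ (diagShift G)^[m]) (diagShift G)

lemma EventuallyCommutes.mul {α β : diag G ≃⋆ₐ[ℂ] diag G} (hα : EventuallyCommutes α)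
    (hβ : EventuallyCommutes β) : EventuallyCommutes (α * β) := by
  obtain ⟨m, hm⟩ := hα
  obtain ⟨n, hn⟩ := hβ
  refine ⟨m + n, fun x => ?_⟩
  have h1 (k : ℕ) (y : diag G) : β ((diagShift G)^[k + n] y) =
      (diagShift G)^[k] (β ((diagShift G)^[n] y)) := by
    rw [add_comm, Function.iterate_add_apply]
    exact (hn.iterate_right k) y
  have h2 := hm (β ((diagShift G)^[n] x))
  simp only [Function.comp_apply, StarAlgEquiv.mul_apply] at h2 ⊢
  have h3 : β ((diagShift G)^[n] (diagShift G x)) = diagShift G (β ((diagShift G)^[n] x)) := hn x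
  rw [h1, h1, h3, h2]

variable (G)

/-- The group of automorphisms `α` of the diagonal such that `α` and `α⁻¹` eventually commute
with the shift. -/
def eventualGroup : Subgroup (diag G ≃⋆ₐ[ℂ] diag G) where
  carrier := {α | EventuallyCommutes α ∧ EventuallyCommutes α⁻¹}
  one_mem' := ⟨⟨0, fun _ => rfl⟩, ⟨0, fun _ => rfl⟩⟩
  mul_mem' hα hβ := ⟨hα.1.mul hβ.1, by rw [mul_inv_rev]; exact hβ.2.mul hα.2⟩
  inv_mem' {α} hα := ⟨hα.2, by rw [inv_inv]; exact hα.1⟩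

/-- The restriction of an automorphism of `C*(G)` that preserves `D_G` and `F_G` to `D_G`. -/
def restrictDiag : autDiagCore G →* (diag G ≃⋆ₐ[ℂ] diag G) :=
  (restrictAut (diag G)).comp (Subgroup.inclusion inf_le_left)

end Weyl

end GraphCStar

end

set_option linter.unusedSectionVars false

noncomputable section

namespace GraphCStar

universe u v

variable {V : Type u} {E : Type v} [Fintype V] [Fintype E] {G : DirectedGraph V E}

/-! ## Relations between the generators -/

/-! The heart of the matter is that an automorphism preserving the core must commute with the gauge
action; eventual commutation with the shift then follows by approximation in the core.

Rigidity of the diagonal: since every loop has an exit, the relative commutant of the diagonal lies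
in the core (`CommutesWithDiag.mem_core`). A spectral component of degree `k > 0` commuting with the
diagonal can be compressed by path isometries, without losing norm, until it is close to a multiple
of some `S_ρ` with `|ρ| = k`. Off loops this compression is zero; on a loop, an exit yields a path
projection that fails to commute with `S_ρ`. Two consequences: with trivial center of the core, only
scalars commute with the core; and if `α` fixes the diagonal, `α(S_e) S_e^*` commutes with it, so
`α(S_e)` has degree one and `α` preserves the core. The latter identifies the kernel.

Degree one in general: choosing one incoming edge at each vertex gives a proper isometry `u` of
degree one. Conjugation by `t = α(u)` preserves the core, and every spectral component `t_k`
intertwines in the same way as `t`, so `t^* t_k` is scalar and `t` is homogeneous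
(`exists_isHomogeneous_apply`). Its degree is positive, because an isometry in the approximately
finite-dimensional core is unitary (`mul_eq_one_of_mem_core`, `degree_pos_of_isometry`). A degree `n
> 1` would put the whole image of `α` in the fixed points of a nontrivial `n`-th root of unity,
contradicting surjectivity.

The shift: now `w_f = S_f α(u)^*` lies in the core and satisfies `φ(α x) w_f = w_f α(φ x)` for `x`
in the diagonal. The elements `α⁻¹(w_f)` are close to a finite-dimensional level of the core, and
that level commutes with a high iterate of `φ` on the diagonal. Hence `φ(α x)` and `α(φ x)` are
close for `x = φ^M(p)`, with `M` independent of the path projection `p`. Both are projections in a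
commutative algebra, so they are equal (`eventuallyCommutes_restrictDiag`). -/

lemma PV_mul_self (v : V) : PV G v * PV G v = PV G v := (univFamily G).P_mul_P v

lemma PV_mul_SE_eq_or (v : V) (e : E) : PV G v * SE G e = SE G e ∨ PV G v * SE G e = 0 := by
  by_cases h : G.s e = v
  · exact .inl (by rw [← h, PV_source_mul_SE])
  · exact .inr (PV_mul_SE v e h)

open Classical in
lemma PV_eq_sum (h : G.NoSinks) (v : V) :
    PV G v = ∑ e with G.s e = v, SE G e * star (SE G e) :=
  (univFamily G).sum_range v (h v)

lemma sum_SE_mul_star (h : G.NoSinks) : ∑ e, SE G e * star (SE G e) = 1 := by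
  classical
  rw [← sum_PV, ← Finset.sum_fiberwise (s := Finset.univ) (g := G.s)]
  exact Finset.sum_congr rfl fun v _ => by rw [PV_eq_sum h]

@[simp] lemma SPath_nil : SPath G [] = 1 := by simp [SPath]

lemma SPath_append (μ ν : List E) : SPath G (μ ++ ν) = SPath G μ * SPath G ν := by
  simp [SPath]

lemma SPath_singleton (e : E) : SPath G [e] = SE G e := by simp [SPath]

lemma PV_mul_SPath_eq_or (v : V) {μ : List E} (hμ : μ ≠ []) :
    PV G v * SPath G μ = SPath G μ ∨ PV G v * SPath G μ = 0 := by
  obtain ⟨e, μ, rfl⟩ := List.exists_cons_of_ne_nil hμ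
  rw [SPath_cons, ← mul_assoc]
  rcases PV_mul_SE_eq_or (G := G) v e with h | h <;> simp [h]

lemma norm_le_one_of_projection {A : Type*} [CStarAlgebra A] {p : A} (hs : star p = p)
    (hp : p * p = p) : ‖p‖ ≤ 1 := by
  have h := CStarRing.norm_star_mul_self (x := p)
  rw [hs, hp] at h
  nlinarith [norm_nonneg p]

lemma norm_SE_le (e : E) : ‖SE G e‖ ≤ 1 := by
  have h := CStarRing.norm_star_mul_self (x := SE G e)
  rw [star_SE_mul_SE] at h
  have := norm_le_one_of_projection (star_PV (G := G) (G.r e)) (PV_mul_self _)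
  nlinarith [norm_nonneg (SE G e)]

lemma norm_SPath_le [Nontrivial (GraphAlg G)] (μ : List E) : ‖SPath G μ‖ ≤ 1 := by
  induction μ with
  | nil => simp
  | cons e μ ih =>
    rw [SPath_cons]
    exact (norm_mul_le _ _).trans (mul_le_one₀ (norm_SE_le e) (norm_nonneg _) ih)

/-! ## The dense subspace spanned by the products `S_μ S_ν^*` -/

variable (G) in
/-- The linear span of the elements `S_μ S_ν^*`. -/
def monomialSpan : Submodule ℂ (GraphAlg G) :=
  Submodule.span ℂ (Set.range fun p : List E × List E => SPath G p.1 * star (SPath G p.2))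

lemma monomial_mem (μ ν : List E) : SPath G μ * star (SPath G ν) ∈ monomialSpan G :=
  Submodule.subset_span ⟨(μ, ν), rfl⟩

lemma mul_mem_monomialSpan {a : GraphAlg G}
    (h : ∀ μ ν, a * (SPath G μ * star (SPath G ν)) ∈ monomialSpan G) {x}
    (hx : x ∈ monomialSpan G) : a * x ∈ monomialSpan G := by
  have : monomialSpan G ≤ (monomialSpan G).comap (LinearMap.mulLeft ℂ a) := by
    refine Submodule.span_le.2 ?_
    rintro _ ⟨⟨μ, ν⟩, rfl⟩
    exact h μ ν
  exact this hx

lemma SE_mul_mem_monomialSpan (e : E) {x : GraphAlg G} (hx : x ∈ monomialSpan G) :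
    SE G e * x ∈ monomialSpan G :=
  mul_mem_monomialSpan (fun μ ν => by
    rw [← mul_assoc, ← SPath_cons]; exact monomial_mem _ _) hx

/-- Monomials are indexed by lists of edges only, the empty list giving `1`. A vertex projection
enters the span through the sum of the `S_e S_e^*`, which is where the absence of sinks is needed.
-/
lemma PV_mul_mem_monomialSpan (hG : G.NoSinks) (v : V) {x : GraphAlg G}
    (hx : x ∈ monomialSpan G) : PV G v * x ∈ monomialSpan G := by
  classical
  refine mul_mem_monomialSpan (fun μ ν => ?_) hx
  rw [← mul_assoc]
  by_cases h : μ = []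
  · subst h
    rw [PV_eq_sum hG, SPath_nil, mul_one, Finset.sum_mul]
    refine sum_mem fun e _ => ?_
    rw [mul_assoc, ← star_mul, ← SPath_singleton, ← SPath_append]
    exact monomial_mem _ _
  · rcases PV_mul_SPath_eq_or (G := G) v h with h | h <;> rw [h]
    · exact monomial_mem _ _
    · rw [zero_mul]; exact zero_mem _

lemma star_SE_mul_mem_monomialSpan (hG : G.NoSinks) (e : E) {x : GraphAlg G}
    (hx : x ∈ monomialSpan G) : star (SE G e) * x ∈ monomialSpan G := by
  refine mul_mem_monomialSpan (fun μ ν => ?_) hx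
  rcases μ with _ | ⟨f, μ⟩
  · rw [SPath_nil, one_mul, ← star_mul, ← SPath_singleton, ← SPath_append]
    simpa using monomial_mem (G := G) [] (ν ++ [e])
  · rw [SPath_cons, mul_assoc, ← mul_assoc]
    by_cases h : e = f
    · subst h
      rw [star_SE_mul_SE]
      exact PV_mul_mem_monomialSpan hG _ (monomial_mem _ _)
    · rw [star_SE_mul_SE_of_ne _ _ h, zero_mul]
      exact zero_mem _

/-- The span contains `1` and is stable under left multiplication by each generator and its adjoint,
so induction on words suffices; products of two general monomials never have to be computed. -/
lemma can_mem_monomialSpan (hG : G.NoSinks) (x : FreeStarAlg (V ⊕ E)) :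
    can G x ∈ monomialSpan G := by
  induction x using MonoidAlgebra.induction_linear with
  | zero => rw [map_zero]; exact zero_mem _
  | add x y hx hy => rw [map_add]; exact add_mem hx hy
  | single a c =>
    have h : (MonoidAlgebra.single a c : FreeStarAlg (V ⊕ E)) =
        c • MonoidAlgebra.single a 1 := by simp [MonoidAlgebra.smul_single]
    rw [h, map_smul]
    refine Submodule.smul_mem _ _ ?_
    clear h
    induction a using FreeMonoid.recOn with
    | one =>
      rw [← MonoidAlgebra.one_def, map_one]
      simpa using monomial_mem (G := G) [] []
    | of_mul l a ih =>
      have h : (MonoidAlgebra.single (FreeMonoid.of l * a) 1 : FreeStarAlg (V ⊕ E)) =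
          MonoidAlgebra.single (FreeMonoid.of l) 1 * MonoidAlgebra.single a 1 := by
        simp [MonoidAlgebra.single_mul_single]
      rw [h, map_mul]
      have hstar (x : V ⊕ E) : (MonoidAlgebra.single (FreeMonoid.of (x, true)) 1 :
          FreeStarAlg (V ⊕ E)) = star (FreeStarAlg.gen x) := by
        simp [FreeStarAlg.gen, FreeStarAlg.star_single, FreeStarAlg.starWord]
      rcases l with ⟨v | e, _ | _⟩
      · exact PV_mul_mem_monomialSpan hG v ih
      · rw [hstar, map_star]
        change star (PV G v) * _ ∈ _
        rw [star_PV]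
        exact PV_mul_mem_monomialSpan hG v ih
      · exact SE_mul_mem_monomialSpan e ih
      · rw [hstar, map_star]
        exact star_SE_mul_mem_monomialSpan hG e ih

lemma mem_closure_monomialSpan (hG : G.NoSinks) (x : GraphAlg G) :
    x ∈ closure (monomialSpan G : Set (GraphAlg G)) :=
  closure_mono (Set.range_subset_iff.2 (can_mem_monomialSpan hG)) (denseRange_can G x)

lemma SPath_mem {K : StarSubalgebra ℂ (GraphAlg G)} (hS : ∀ e, SE G e ∈ K) (μ : List E) :
    SPath G μ ∈ K := by
  induction μ with
  | nil => rw [SPath_nil]; exact one_mem K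
  | cons e μ ih => rw [SPath_cons]; exact mul_mem (hS e) ih

/-- A closed `*`-subalgebra that contains the generating partial isometries is everything. -/
lemma mem_of_isClosed_of_SE_mem (hG : G.NoSinks) {K : StarSubalgebra ℂ (GraphAlg G)}
    (hK : IsClosed (K : Set (GraphAlg G))) (hS : ∀ e, SE G e ∈ K) (x : GraphAlg G) : x ∈ K := by
  have h : (monomialSpan G : Set (GraphAlg G)) ⊆ K := by
    have : monomialSpan G ≤ Subalgebra.toSubmodule K.toSubalgebra := by
      refine Submodule.span_le.2 ?_
      rintro _ ⟨⟨μ, ν⟩, rfl⟩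
      exact K.mul_mem' (SPath_mem hS μ) (star_mem (SPath_mem hS ν))
    exact this
  exact closure_minimal h hK (mem_closure_monomialSpan hG x)

lemma continuous_starAlgHom {A B : Type*} [CStarAlgebra A] [CStarAlgebra B] (α : A →⋆ₐ[ℂ] B) :
    Continuous α :=
  AddMonoidHomClass.continuous_of_bound α 1 fun x => by
    rw [one_mul]; exact NonUnitalStarAlgHom.norm_apply_le α x

/-- Two `*`-homomorphisms that agree on the generating partial isometries are equal. -/
lemma starAlgHom_eq_of_SE {B : Type*} [CStarAlgebra B] (hG : G.NoSinks)
    (α β : GraphAlg G →⋆ₐ[ℂ] B) (h : ∀ e, α (SE G e) = β (SE G e)) (x : GraphAlg G) :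
    α x = β x := by
  have hK : IsClosed (StarAlgHom.equalizer α β : Set (GraphAlg G)) :=
    isClosed_eq (continuous_starAlgHom α) (continuous_starAlgHom β)
  exact mem_of_isClosed_of_SE_mem hG hK h x

/-! ## The gauge action -/

@[simp] lemma gauge_SE (z : Circle) (e : E) : gauge G z (SE G e) = (z : ℂ) • SE G e :=
  (gaugeFamily G z).lift_S e

@[simp] lemma gauge_PV (z : Circle) (v : V) : gauge G z (PV G v) = PV G v :=
  (gaugeFamily G z).lift_P v

lemma gauge_SPath (z : Circle) (μ : List E) :
    gauge G z (SPath G μ) = ((z ^ μ.length : Circle) : ℂ) • SPath G μ := by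
  induction μ with
  | nil => simp
  | cons e μ ih =>
    rw [SPath_cons, map_mul, ih, gauge_SE, smul_mul_smul_comm, List.length_cons, pow_succ']
    simp

lemma gauge_mul (hG : G.NoSinks) (z w : Circle) (x : GraphAlg G) :
    gauge G (z * w) x = gauge G z (gauge G w x) := by
  refine starAlgHom_eq_of_SE hG (gauge G (z * w)) ((gauge G z).comp (gauge G w)) (fun e => ?_) x
  simp [smul_smul, mul_comm]

lemma gauge_one (hG : G.NoSinks) (x : GraphAlg G) : gauge G 1 x = x :=
  starAlgHom_eq_of_SE hG (gauge G 1) (StarAlgHom.id ℂ _) (fun e => by simp) x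

lemma norm_gauge_le (z : Circle) (x : GraphAlg G) : ‖gauge G z x‖ ≤ ‖x‖ :=
  NonUnitalStarAlgHom.norm_apply_le (gauge G z) x

variable (G) in
/-- The spectral subspace of degree `k` of the gauge action. -/
def IsHomogeneous (k : ℤ) (x : GraphAlg G) : Prop :=
  ∀ z : Circle, gauge G z x = ((z ^ k : Circle) : ℂ) • x

lemma mem_core_iff {x : GraphAlg G} : x ∈ core G ↔ IsHomogeneous G 0 x := by
  simp only [IsHomogeneous, zpow_zero, Circle.coe_one, one_smul]; rfl

lemma IsHomogeneous.mul {k l : ℤ} {x y : GraphAlg G} (hx : IsHomogeneous G k x)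
    (hy : IsHomogeneous G l y) : IsHomogeneous G (k + l) (x * y) := fun z => by
  rw [map_mul, hx, hy, smul_mul_smul_comm, zpow_add, Circle.coe_mul]

lemma IsHomogeneous.adjoint {k : ℤ} {x : GraphAlg G} (hx : IsHomogeneous G k x) :
    IsHomogeneous G (-k) (star x) := fun z => by
  rw [map_star, hx, star_smul, zpow_neg, Circle.coe_inv_eq_conj]
  rfl

lemma IsHomogeneous.sum {ι : Type*} {s : Finset ι} {k : ℤ} {x : ι → GraphAlg G}
    (hx : ∀ i ∈ s, IsHomogeneous G k (x i)) : IsHomogeneous G k (∑ i ∈ s, x i) := fun z => by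
  rw [map_sum, Finset.smul_sum]
  exact Finset.sum_congr rfl fun i hi => hx i hi z

lemma isHomogeneous_SE (e : E) : IsHomogeneous G 1 (SE G e) := fun z => by simp

lemma isHomogeneous_PV (v : V) : IsHomogeneous G 0 (PV G v) := fun z => by simp

lemma isHomogeneous_SPath (μ : List E) : IsHomogeneous G μ.length (SPath G μ) := fun z => by
  rw [gauge_SPath, zpow_natCast]

lemma isHomogeneous_monomial (μ ν : List E) :
    IsHomogeneous G (μ.length - ν.length) (SPath G μ * star (SPath G ν)) := by
  rw [sub_eq_add_neg]
  exact (isHomogeneous_SPath μ).mul (isHomogeneous_SPath ν).adjoint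

lemma IsHomogeneous.pow {k : ℤ} {x : GraphAlg G} (hx : IsHomogeneous G k x) (n : ℕ) :
    IsHomogeneous G (n * k) (x ^ n) := fun z => by
  rw [map_pow, hx, smul_pow, ← Circle.coe_pow, ← zpow_natCast, ← zpow_mul, mul_comm k]

/-! ## Spectral components -/

section SpectralComponents

open MeasureTheory AddCircle

/-- The orbit of a monomial is a character times a constant, and contractivity of the gauge maps
turns approximation of `x` into uniform approximation of its orbit. -/
lemma continuous_gauge_apply (hG : G.NoSinks) (x : GraphAlg G) :
    Continuous fun z : Circle => gauge G z x := by
  have hm : ∀ y ∈ monomialSpan G, Continuous fun z : Circle => gauge G z y := by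
    intro y hy
    induction hy using Submodule.span_induction with
    | mem y hy =>
      obtain ⟨⟨μ, ν⟩, rfl⟩ := hy
      simp only [isHomogeneous_monomial μ ν _]
      exact (Continuous.comp (by fun_prop : Continuous fun z : Circle => (z : ℂ)) (continuous_zpow _)).smul continuous_const
    | zero => simpa using continuous_const
    | add y y' _ _ hy hy' => simp only [map_add]; exact hy.add hy'
    | smul c y _ hy => simp only [map_smul]; exact hy.const_smul c
  refine continuous_of_uniform_approx_of_continuous fun s hs => ?_
  obtain ⟨ε, hε, hs⟩ := Metric.mem_uniformity_dist.1 hs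
  obtain ⟨y, hy, hxy⟩ := Metric.mem_closure_iff.1 (mem_closure_monomialSpan hG x) ε hε
  refine ⟨_, hm y hy, fun z => hs ?_⟩
  rw [dist_eq_norm, ← map_sub]
  rw [dist_eq_norm] at hxy
  exact (norm_gauge_le z _).trans_lt hxy

lemma continuous_orbit (hG : G.NoSinks) (x : GraphAlg G) :
    Continuous fun t : UnitAddCircle => gauge G (toCircle t) x :=
  (continuous_gauge_apply hG x).comp continuous_toCircle

lemma continuous_weighted_orbit (hG : G.NoSinks) (k : ℤ) (x : GraphAlg G) :
    Continuous fun t : UnitAddCircle => fourier k t • gauge G (toCircle t) x :=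
  (map_continuous (fourier k)).smul (continuous_orbit hG x)

lemma integrable_weighted_orbit (hG : G.NoSinks) (k : ℤ) (x : GraphAlg G) :
    Integrable (fun t : UnitAddCircle => fourier k t • gauge G (toCircle t) x) haarAddCircle :=
  (continuous_weighted_orbit hG k x).integrable_of_hasCompactSupport
    (HasCompactSupport.of_compactSpace _)

/-- The projection onto the spectral subspace of degree `k`. -/
def spectralProj (hG : G.NoSinks) (k : ℤ) : GraphAlg G →L[ℂ] GraphAlg G :=
  LinearMap.mkContinuous
    { toFun := fun x => fourierCoeff (fun t : UnitAddCircle => gauge G (toCircle t) x) k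
      map_add' := fun x y => by
        simp only [fourierCoeff, map_add, smul_add]
        exact integral_add (integrable_weighted_orbit hG _ x) (integrable_weighted_orbit hG _ y)
      map_smul' := fun c x => by
        simp only [fourierCoeff, map_smul, smul_comm _ c, integral_smul, RingHom.id_apply] }
    1 fun x => by
      refine (norm_integral_le_of_norm_le_const (C := 1 * ‖x‖) (ae_of_all _ fun t => ?_)).trans ?_
      · rw [norm_smul, fourier_apply, Circle.norm_coe, one_mul, one_mul]
        exact norm_gauge_le _ _
      · simp

lemma spectralProj_apply (hG : G.NoSinks) (k : ℤ) (x : GraphAlg G) :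
    spectralProj hG k x = ∫ t : UnitAddCircle, fourier (-k) t • gauge G (toCircle t) x
      ∂haarAddCircle := rfl

lemma norm_spectralProj_le (hG : G.NoSinks) (k : ℤ) (x : GraphAlg G) :
    ‖spectralProj hG k x‖ ≤ ‖x‖ := by
  have := (spectralProj hG k).le_of_opNorm_le (LinearMap.mkContinuous_norm_le _ zero_le_one _) x
  rwa [one_mul] at this

lemma spectralProj_mul_left (hG : G.NoSinks) (k : ℤ) {y : GraphAlg G} (hy : y ∈ core G)
    (x : GraphAlg G) : spectralProj hG k (y * x) = y * spectralProj hG k x := by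
  have : y * spectralProj hG k x =
    ContinuousLinearMap.mul ℂ (GraphAlg G) y (spectralProj hG k x) := rfl
  rw [this, spectralProj_apply, spectralProj_apply, ← ContinuousLinearMap.integral_comp_comm _
      (integrable_weighted_orbit hG _ x)]
  refine integral_congr_ae (ae_of_all _ fun t => ?_)
  simp [hy (toCircle t)]

lemma spectralProj_mul_right (hG : G.NoSinks) (k : ℤ) {y : GraphAlg G} (hy : y ∈ core G)
    (x : GraphAlg G) : spectralProj hG k (x * y) = spectralProj hG k x * y := by
  have : spectralProj hG k x * y =
    (ContinuousLinearMap.mul ℂ (GraphAlg G)).flip y (spectralProj hG k x) := rfl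
  rw [this, spectralProj_apply, spectralProj_apply, ← ContinuousLinearMap.integral_comp_comm _
      (integrable_weighted_orbit hG _ x)]
  refine integral_congr_ae (ae_of_all _ fun t => ?_)
  simp [hy (toCircle t)]

lemma toCircle_zsmul_coe (k : ℤ) (t : UnitAddCircle) :
    ((toCircle t ^ k : Circle) : ℂ) = fourier k t := by
  rw [fourier_apply, toCircle_zsmul]

lemma exists_toCircle_eq (z : Circle) : ∃ t : UnitAddCircle, toCircle t = z :=
  by
  obtain ⟨t, ht⟩ := (homeomorphCircle (T := 1) one_ne_zero).surjective z
  exact ⟨t, by rwa [homeomorphCircle_apply] at ht⟩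

lemma isHomogeneous_spectralProj (hG : G.NoSinks) (k : ℤ) (x : GraphAlg G) :
    IsHomogeneous G k (spectralProj hG k x) := by
  intro z
  obtain ⟨s, rfl⟩ := exists_toCircle_eq z
  let L : GraphAlg G →L[ℂ] GraphAlg G :=
    ⟨(gauge G (toCircle s) : GraphAlg G →ₐ[ℂ] GraphAlg G).toLinearMap,
      continuous_starAlgHom (gauge G (toCircle s))⟩
  change L _ = _
  -- Translation invariance of Haar measure replaces `t` by `t + s` in the right-hand integral; the
  -- extra factor of the Fourier character cancels the scalar `z ^ k`.
  rw [spectralProj_apply, ← ContinuousLinearMap.integral_comp_comm _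
      (integrable_weighted_orbit hG _ x), ← integral_smul,
    ← integral_add_right_eq_self (μ := haarAddCircle) (fun t => (_ : ℂ) • _) s]
  refine integral_congr_ae (ae_of_all _ fun t => ?_)
  have h1 : fourier (-k) (t + s) = fourier (-k) t * fourier (-k) s := by
    simp only [fourier_apply, zsmul_add, toCircle_add, Circle.coe_mul]
  have h2 : fourier k s * fourier (-k) s = 1 := by
    rw [← fourier_add, add_neg_cancel, fourier_zero]
  have h3 : L (gauge G (toCircle t) x) = gauge G (toCircle (t + s)) x := by
    rw [add_comm, toCircle_add, gauge_mul hG]; rfl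
  simp only [map_smul]
  rw [h3, smul_smul, h1, toCircle_zsmul_coe, mul_left_comm, h2, mul_one]

lemma spectralProj_of_isHomogeneous (hG : G.NoSinks) {j : ℤ} {x : GraphAlg G}
    (hx : IsHomogeneous G j x) (k : ℤ) : spectralProj hG k x = if k = j then x else 0 := by
  simp only [spectralProj_apply, hx _, toCircle_zsmul_coe, smul_smul]
  rw [integral_smul_const]
  have := congrFun (fourierCoeff_fourier (T := 1) j) k
  rw [fourierCoeff] at this
  simp only [smul_eq_mul] at this
  rw [this, Pi.single_apply]
  split_ifs <;> simp

/-- An element with at most one nonzero spectral component is homogeneous. -/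
lemma isHomogeneous_of_spectralProj_eq_zero (hG : G.NoSinks) {j : ℤ} {x : GraphAlg G}
    (hx : ∀ k ≠ j, spectralProj hG k x = 0) : IsHomogeneous G j x := by
  intro z
  obtain ⟨s, rfl⟩ := exists_toCircle_eq z
  -- Functionals reduce the claim to a continuous scalar function whose Fourier coefficients vanish
  -- off `j`. Its series is summable, hence converges pointwise, and evaluation at `0` determines
  -- the remaining coefficient.
  refine (SeparatingDual.eq_iff_forall_dual_eq (R := ℂ)).2 fun ψ => ?_
  let f : C(UnitAddCircle, ℂ) :=
    ⟨fun t => ψ (gauge G (toCircle t) x), ψ.continuous.comp (continuous_orbit hG x)⟩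
  have hf (k : ℤ) : fourierCoeff f k = ψ (spectralProj hG k x) := by
    rw [spectralProj_apply, ← ContinuousLinearMap.integral_comp_comm _
      (integrable_weighted_orbit hG _ x)]
    simp only [map_smul]
    rfl
  have hz (k : ℤ) (hk : k ≠ j) : fourierCoeff f k = 0 := by rw [hf, hx k hk, map_zero]
  have hs : Summable (fourierCoeff f) :=
    summable_of_ne_finset_zero (s := {j}) fun k hk => hz k (by simpa using hk)
  have key (t : UnitAddCircle) : f t = fourierCoeff f j * fourier j t :=
    (has_pointwise_sum_fourier_series_of_summable hs t).unique
      (hasSum_single j fun k hk => by rw [hz k hk, zero_smul])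
  have h0 : f 0 = ψ x := by
    change ψ (gauge G (toCircle 0) x) = ψ x
    rw [toCircle_zero, gauge_one hG]
  have h1 := key 0
  rw [fourier_eval_zero, mul_one, h0] at h1
  rw [map_smul, toCircle_zsmul_coe, h1, smul_eq_mul, mul_comm]
  exact key s

end SpectralComponents

/-! ## A filtration of the spectral subspaces -/

variable (G) in
/-- The map `x ↦ S_e x S_f^*`. -/
def sandwich (e f : E) : GraphAlg G →ₗ[ℂ] GraphAlg G :=
  LinearMap.mulRight ℂ (star (SE G f)) ∘ₗ LinearMap.mulLeft ℂ (SE G e)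

variable (G) in
/-- The span of the elements `S_μ P_v S_ρ P_w S_ν^*` with `|ρ| = k` and `|μ| = |ν| = m`. -/
def homSpace (k : ℕ) : ℕ → Submodule ℂ (GraphAlg G)
  | 0 => Submodule.span ℂ {x | ∃ v w ρ, ρ.length = k ∧ x = PV G v * SPath G ρ * PV G w}
  | m + 1 => ⨆ p : E × E, (homSpace k m).map (sandwich G p.1 p.2)

lemma sandwich_mem_homSpace (e f : E) {k m : ℕ} {x : GraphAlg G} (hx : x ∈ homSpace G k m) :
    SE G e * x * star (SE G f) ∈ homSpace G k (m + 1) :=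
  (le_iSup (fun p : E × E => (homSpace G k m).map (sandwich G p.1 p.2)) (e, f))
    (Submodule.mem_map_of_mem hx)

lemma homSpace_succ_le {k m : ℕ} {W : Submodule ℂ (GraphAlg G)}
    (h : ∀ e f, ∀ x ∈ homSpace G k m, SE G e * x * star (SE G f) ∈ W) :
    homSpace G k (m + 1) ≤ W := by
  refine iSup_le fun p => ?_
  rintro _ ⟨x, hx, rfl⟩
  exact h _ _ x hx

lemma corner_mem_homSpace (v w : V) {k : ℕ} {ρ : List E} (h : ρ.length = k) :
    PV G v * SPath G ρ * PV G w ∈ homSpace G k 0 :=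
  Submodule.subset_span ⟨v, w, ρ, h, rfl⟩

lemma homSpace_zero_le {k : ℕ} {W : Submodule ℂ (GraphAlg G)}
    (h : ∀ v w ρ, ρ.length = k → PV G v * SPath G ρ * PV G w ∈ W) : homSpace G k 0 ≤ W := by
  refine Submodule.span_le.2 ?_
  rintro _ ⟨v, w, ρ, hρ, rfl⟩
  exact h v w ρ hρ

lemma SPath_mem_homSpace {k : ℕ} {ρ : List E} (h : ρ.length = k) :
    SPath G ρ ∈ homSpace G k 0 := by
  have : SPath G ρ = ∑ v, ∑ w, PV G v * SPath G ρ * PV G w := by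
    simp_rw [← Finset.mul_sum, sum_PV, mul_one, ← Finset.sum_mul, sum_PV, one_mul]
  rw [this]
  exact sum_mem fun v _ => sum_mem fun w _ => corner_mem_homSpace v w h

lemma monomial_mem_homSpace {k : ℕ} {μ ν : List E} (h : μ.length = ν.length + k) :
    SPath G μ * star (SPath G ν) ∈ homSpace G k ν.length := by
  induction ν generalizing μ with
  | nil => simpa using SPath_mem_homSpace (G := G) (by simpa using h)
  | cons f ν ih =>
    rcases μ with _ | ⟨e, μ⟩
    · simp at h
      omega
    · have h' : μ.length = ν.length + k := by simp at h; omega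
      have := sandwich_mem_homSpace e f (ih h')
      rw [SPath_cons, SPath_cons, star_mul]
      simpa only [mul_assoc, List.length_cons] using this

lemma mem_homSpace_of_map {k m n : ℕ} (L : GraphAlg G →ₗ[ℂ] GraphAlg G)
    (h : homSpace G k m ≤ (homSpace G k n).comap L) {x} (hx : x ∈ homSpace G k m) :
    L x ∈ homSpace G k n := h hx

lemma PV_mul_mem_homSpace (v : V) {k m : ℕ} {x : GraphAlg G} (hx : x ∈ homSpace G k m) :
    PV G v * x ∈ homSpace G k m := by
  refine mem_homSpace_of_map (LinearMap.mulLeft ℂ (PV G v)) ?_ hx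
  rcases m with _ | m
  · refine homSpace_zero_le fun u w ρ hρ => ?_
    change PV G v * (PV G u * SPath G ρ * PV G w) ∈ homSpace G k 0
    rw [← mul_assoc, ← mul_assoc]
    by_cases h : v = u
    · rw [h, PV_mul_self]; exact corner_mem_homSpace u w hρ
    · rw [PV_mul_PV _ _ h, zero_mul, zero_mul]; exact zero_mem _
  · refine homSpace_succ_le fun e f y hy => ?_
    change PV G v * (SE G e * y * star (SE G f)) ∈ homSpace G k (m + 1)
    rw [← mul_assoc, ← mul_assoc]
    rcases PV_mul_SE_eq_or (G := G) v e with h | h <;> rw [h]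
    · exact sandwich_mem_homSpace e f hy
    · rw [zero_mul, zero_mul]; exact zero_mem _

lemma mul_PV_mem_homSpace (v : V) {k m : ℕ} {x : GraphAlg G} (hx : x ∈ homSpace G k m) :
    x * PV G v ∈ homSpace G k m := by
  refine mem_homSpace_of_map (LinearMap.mulRight ℂ (PV G v)) ?_ hx
  rcases m with _ | m
  · refine homSpace_zero_le fun u w ρ hρ => ?_
    change PV G u * SPath G ρ * PV G w * PV G v ∈ homSpace G k 0
    rw [mul_assoc]
    by_cases h : w = v
    · rw [h, PV_mul_self]; exact corner_mem_homSpace u v hρ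
    · rw [PV_mul_PV _ _ h, mul_zero]; exact zero_mem _
  · refine homSpace_succ_le fun e f y hy => ?_
    change SE G e * y * star (SE G f) * PV G v ∈ homSpace G k (m + 1)
    rw [mul_assoc, show star (SE G f) * PV G v = star (PV G v * SE G f) by
      rw [star_mul, star_PV]]
    rcases PV_mul_SE_eq_or (G := G) v f with h | h <;> rw [h]
    · exact sandwich_mem_homSpace e f hy
    · rw [star_zero, mul_zero]; exact zero_mem _

/-- Expanding the right-hand vertex projection as a sum of `S_e S_e^*` lengthens both sides of a
level-zero element by one edge; the sandwiches carry this to higher levels. -/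
lemma homSpace_le_succ (hG : G.NoSinks) (k m : ℕ) : homSpace G k m ≤ homSpace G k (m + 1) := by
  classical
  induction m with
  | zero =>
    refine homSpace_zero_le fun v w ρ hρ => ?_
    rw [PV_eq_sum hG w, Finset.mul_sum]
    refine sum_mem fun e _ => ?_
    have h1 : PV G v * SPath G ρ * (SE G e * star (SE G e)) =
        PV G v * (SPath G (ρ ++ [e]) * star (SE G e)) := by
      rw [SPath_append, SPath_singleton]; simp only [mul_assoc]
    rw [h1]
    refine PV_mul_mem_homSpace v ?_
    have := monomial_mem_homSpace (G := G) (k := k) (μ := ρ ++ [e]) (ν := [e])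
      (by simp [hρ, add_comm])
    simpa [SPath_singleton] using this
  | succ m ih =>
    exact homSpace_succ_le fun e f x hx => sandwich_mem_homSpace e f (ih hx)

lemma homSpace_mono (hG : G.NoSinks) (k : ℕ) : Monotone (homSpace G k) :=
  monotone_nat_of_le_succ (homSpace_le_succ hG k)

lemma one_mem_homSpace (hG : G.NoSinks) (m : ℕ) : (1 : GraphAlg G) ∈ homSpace G 0 m :=
  homSpace_mono hG 0 (Nat.zero_le m) (by simpa using SPath_mem_homSpace (G := G) (ρ := []) rfl)

lemma star_SE_mul_sandwich (e f g h : E) (x : GraphAlg G) :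
    star (SE G e) * (SE G f * x * star (SE G g)) * SE G h = 0 ∨
      star (SE G e) * (SE G f * x * star (SE G g)) * SE G h =
        PV G (G.r e) * x * PV G (G.r h) := by
  have h1 : star (SE G e) * (SE G f * x * star (SE G g)) * SE G h =
      (star (SE G e) * SE G f) * x * (star (SE G g) * SE G h) := by simp only [mul_assoc]
  rw [h1]
  by_cases hef : e = f
  · by_cases hgh : g = h
    · subst hef hgh
      exact .inr (by rw [star_SE_mul_SE, star_SE_mul_SE])
    · exact .inl (by rw [star_SE_mul_SE_of_ne _ _ hgh, mul_zero])
  · exact .inl (by rw [star_SE_mul_SE_of_ne _ _ hef, zero_mul, zero_mul])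

/-- Compression undoes a sandwich up to vertex projections on both sides, and these are absorbed
because level zero has such corners built in. -/
lemma compress_mem_homSpace (e : E) {k m : ℕ} {x : GraphAlg G} (hx : x ∈ homSpace G k (m + 1)) :
    star (SE G e) * x * SE G e ∈ homSpace G k m := by
  have : homSpace G k (m + 1) ≤ (homSpace G k m).comap
      (LinearMap.mulRight ℂ (SE G e) ∘ₗ LinearMap.mulLeft ℂ (star (SE G e))) := by
    refine homSpace_succ_le fun f g y hy => ?_
    change star (SE G e) * (SE G f * y * star (SE G g)) * SE G e ∈ homSpace G k m
    rcases star_SE_mul_sandwich e f g e y with h | h <;> rw [h]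
    · exact zero_mem _
    · exact mul_PV_mem_homSpace _ (PV_mul_mem_homSpace _ hy)
  exact this hx

/-- The elements of degree `k ≥ 0` are limits of elements of the spaces `homSpace G k m`. -/
lemma IsHomogeneous.exists_homSpace (hG : G.NoSinks) {k : ℕ} {x : GraphAlg G}
    (hx : IsHomogeneous G k x) {ε : ℝ} (hε : 0 < ε) :
    ∃ m, ∃ y ∈ homSpace G k m, ‖x - y‖ < ε := by
  obtain ⟨y, hy, hxy⟩ := Metric.mem_closure_iff.1 (mem_closure_monomialSpan hG x) ε hε
  -- The spectral projection discards the monomials of degree other than `k`. Being contractive and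
  -- fixing `x`, it does not worsen the approximation.
  have hle : monomialSpan G ≤ (⨆ m, homSpace G k m).comap (spectralProj hG k).toLinearMap := by
    refine Submodule.span_le.2 ?_
    rintro _ ⟨⟨μ, ν⟩, rfl⟩
    change spectralProj hG k (SPath G μ * star (SPath G ν)) ∈ ⨆ m, homSpace G k m
    rw [spectralProj_of_isHomogeneous hG (isHomogeneous_monomial μ ν)]
    split_ifs with h
    · exact (le_iSup (homSpace G k) ν.length) (monomial_mem_homSpace (by omega))
    · exact zero_mem _
  obtain ⟨m, hm⟩ := (Submodule.mem_iSup_of_directed _ (homSpace_mono hG k).directed_le).1 (hle hy)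
  refine ⟨m, _, hm, ?_⟩
  have h1 : spectralProj hG k x = x := by rw [spectralProj_of_isHomogeneous hG hx, if_pos rfl]
  rw [dist_eq_norm] at hxy
  calc ‖x - spectralProj hG k y‖ = ‖spectralProj hG k (x - y)‖ := by rw [map_sub, h1]
    _ ≤ ‖x - y‖ := norm_spectralProj_le hG _ _
    _ < ε := hxy

/-! ## The finite-dimensional subalgebras of the core -/

lemma exists_homSpace_of_mem_core (hG : G.NoSinks) {x : GraphAlg G} (hx : x ∈ core G) {ε : ℝ}
    (hε : 0 < ε) : ∃ m, ∃ y ∈ homSpace G 0 m, ‖x - y‖ < ε :=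
  IsHomogeneous.exists_homSpace hG (by simpa using mem_core_iff.1 hx) hε

lemma PV_mem_core (v : V) : PV G v ∈ core G := mem_core_iff.2 (isHomogeneous_PV v)

lemma mul_mem_homSpace {m : ℕ} {x y : GraphAlg G} (hx : x ∈ homSpace G 0 m)
    (hy : y ∈ homSpace G 0 m) : x * y ∈ homSpace G 0 m := by
  induction m generalizing x y with
  | zero =>
    have : homSpace G 0 0 ≤ (homSpace G 0 0).comap (LinearMap.mulRight ℂ y) := by
      refine homSpace_zero_le fun v w ρ hρ => ?_
      rw [List.length_eq_zero_iff.1 hρ, SPath_nil, mul_one]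
      change PV G v * PV G w * y ∈ homSpace G 0 0
      rw [mul_assoc]
      exact PV_mul_mem_homSpace v (PV_mul_mem_homSpace w hy)
    exact this hx
  | succ m ih =>
    have : homSpace G 0 (m + 1) ≤ (homSpace G 0 (m + 1)).comap (LinearMap.mulRight ℂ y) := by
      refine homSpace_succ_le fun e f a ha => ?_
      have : homSpace G 0 (m + 1) ≤ (homSpace G 0 (m + 1)).comap
          (LinearMap.mulLeft ℂ (SE G e * a * star (SE G f))) := by
        refine homSpace_succ_le fun g h b hb => ?_
        change SE G e * a * star (SE G f) * (SE G g * b * star (SE G h)) ∈ homSpace G 0 (m + 1)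
        have h1 : SE G e * a * star (SE G f) * (SE G g * b * star (SE G h)) =
            SE G e * (a * ((star (SE G f) * SE G g) * b)) * star (SE G h) := by
          simp only [mul_assoc]
        rw [h1]
        refine sandwich_mem_homSpace e h (ih ha ?_)
        by_cases hfg : f = g
        · rw [hfg, star_SE_mul_SE]; exact PV_mul_mem_homSpace _ hb
        · rw [star_SE_mul_SE_of_ne _ _ hfg, zero_mul]; exact zero_mem _
      exact this hy
    exact this hx

instance finiteDimensional_homSpace (m : ℕ) : FiniteDimensional ℂ (homSpace G 0 m) := by
  induction m with
  | zero =>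
    refine FiniteDimensional.span_of_finite ℂ ?_
    refine (Set.finite_range fun p : V × V => PV G p.1 * PV G p.2).subset ?_
    rintro _ ⟨v, w, ρ, hρ, rfl⟩
    exact ⟨(v, w), by simp [List.length_eq_zero_iff.1 hρ]⟩
  | succ m ih =>
    change FiniteDimensional ℂ ↥(⨆ p : E × E, (homSpace G 0 m).map (sandwich G p.1 p.2))
    infer_instance

/-- The core is a finite algebra: left invertible elements are invertible. -/
lemma mul_eq_one_of_mem_core (hG : G.NoSinks) {x y : GraphAlg G} (hx : x ∈ core G)
    (h : y * x = 1) : x * y = 1 := by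
  -- This accuracy puts `y * a` at distance less than one from `y * x = 1`, so that `y * a` is
  -- invertible.
  obtain ⟨m, a, ha, hxa⟩ := exists_homSpace_of_mem_core hG hx
    (show 0 < (‖y‖ + 1)⁻¹ by positivity)
  have hu : IsUnit (y * a) := by
    have h1 : y * a = 1 - y * (x - a) := by rw [mul_sub, h]; abel
    rw [h1]
    refine isUnit_one_sub_of_norm_lt_one ((norm_mul_le _ _).trans_lt ?_)
    calc ‖y‖ * ‖x - a‖ ≤ (‖y‖ + 1) * ‖x - a‖ := by gcongr; simp
      _ < (‖y‖ + 1) * (‖y‖ + 1)⁻¹ := by gcongr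
      _ = 1 := mul_inv_cancel₀ (by positivity)
  -- Left multiplication by `a` on a finite-dimensional algebra is injective, hence onto; a preimage
  -- of `1` is a right inverse of `a`.
  let L : homSpace G 0 m →ₗ[ℂ] homSpace G 0 m :=
    (LinearMap.mulLeft ℂ a).restrict fun b hb => mul_mem_homSpace ha hb
  have hL : Function.Injective L := by
    rw [← LinearMap.ker_eq_bot, LinearMap.ker_eq_bot']
    intro b hb
    have hb' : a * (b : GraphAlg G) = 0 := congrArg Subtype.val hb
    have : y * a * (b : GraphAlg G) = 0 := by rw [mul_assoc, hb', mul_zero]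
    exact Subtype.ext ((hu.mul_right_eq_zero).1 this)
  obtain ⟨b, hb⟩ := (LinearMap.injective_iff_surjective.1 hL) ⟨1, one_mem_homSpace hG m⟩
  have hb' : a * (b : GraphAlg G) = 1 := congrArg Subtype.val hb
  have h2 : y = y * a * b := by rw [mul_assoc, hb', mul_one]
  have ha' : IsUnit a := by
    obtain ⟨u, hu⟩ := hu
    refine ⟨⟨a, b, hb', ?_⟩, rfl⟩
    have h3 : (↑u⁻¹ * y) * a = 1 := by rw [mul_assoc, ← hu, Units.inv_mul]
    have h4 : (↑u⁻¹ * y) = b := by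
      calc ↑u⁻¹ * y = ↑u⁻¹ * y * (a * b) := by rw [hb', mul_one]
        _ = b := by rw [← mul_assoc, h3, one_mul]
    rw [← h4, h3]
  have hy : IsUnit y := by
    obtain ⟨w, rfl⟩ := ha'
    rw [Units.isUnit_mul_units] at hu
    exact hu
  obtain ⟨w, rfl⟩ := hy
  rw [Units.mul_eq_one_iff_inv_eq] at h
  rw [← h, Units.inv_mul]

/-! ## The diagonal -/

lemma SPath_eq_zero_of_not_isPath {μ : List E} (h : ¬G.IsPath μ) : SPath G μ = 0 := by
  induction μ with
  | nil => exact absurd List.isChain_nil h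
  | cons e μ ih =>
    rw [SPath_cons]
    rcases μ with _ | ⟨f, μ⟩
    · exact absurd (List.isChain_singleton _) h
    · by_cases hef : G.r e = G.s f
      · rw [ih fun h' => h (List.isChain_cons_cons.2 ⟨hef, h'⟩), mul_zero]
      · rw [SPath_cons, ← mul_assoc, SE_mul_SE_of_ne _ _ hef, zero_mul]

lemma SPath_mul_star_mem_diag {μ : List E} (hμ : μ ≠ []) :
    SPath G μ * star (SPath G μ) ∈ diag G := by
  by_cases h : G.IsPath μ
  · exact pathProjections_subset (.inr ⟨μ, hμ, h, rfl⟩)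
  · rw [SPath_eq_zero_of_not_isPath h, zero_mul]
    exact zero_mem _

lemma PV_mem_diag (v : V) : PV G v ∈ diag G := pathProjections_subset (.inl ⟨v, rfl⟩)

/-- To commute with the diagonal it suffices to commute with the path projections. -/
lemma commute_diag {x : GraphAlg G} (h : ∀ p ∈ pathProjections G, p * x = x * p)
    (h' : ∀ p ∈ pathProjections G, p * star x = star x * p) {d : GraphAlg G}
    (hd : d ∈ diag G) : d * x = x * d := by
  have hle : diag G ≤ StarSubalgebra.centralizer ℂ {x} := by
    refine StarSubalgebra.topologicalClosure_minimal (StarAlgebra.adjoin_le fun p hp => ?_) ?_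
    · rw [SetLike.mem_coe, StarSubalgebra.mem_centralizer_iff]
      rintro y rfl
      exact ⟨(h p hp).symm, (h' p hp).symm⟩
    · exact Set.isClosed_centralizer _
  have := (StarSubalgebra.mem_centralizer_iff ℂ).1 (hle hd) x rfl
  exact this.1.symm

lemma star_pathProjection {p : GraphAlg G} (hp : p ∈ pathProjections G) : star p = p := by
  rcases hp with ⟨v, rfl⟩ | ⟨μ, -, -, rfl⟩
  · exact star_PV v
  · rw [star_mul, star_star]

/-- Different first edges make both products vanish. A common first edge is peeled off, leaving a
vertex projection that commutes with both remaining factors. -/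
lemma commute_SPath_mul_star (μ ν : List E) :
    Commute (SPath G μ * star (SPath G μ)) (SPath G ν * star (SPath G ν)) := by
  induction μ generalizing ν with
  | nil => simp
  | cons e μ ih =>
    rcases ν with _ | ⟨f, ν⟩
    · simp
    · have key (e f : E) (μ ν : List E) :
          SPath G (e :: μ) * star (SPath G (e :: μ)) *
            (SPath G (f :: ν) * star (SPath G (f :: ν))) =
          SE G e * (SPath G μ * star (SPath G μ)) * (star (SE G e) * SE G f) *
            (SPath G ν * star (SPath G ν)) * star (SE G f) := by
        rw [SPath_cons, SPath_cons, star_mul, star_mul]; simp only [mul_assoc]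
      rw [Commute, SemiconjBy, key, key]
      by_cases hef : e = f
      · subst hef
        have hc (v : V) (μ : List E) : Commute (PV G v) (SPath G μ * star (SPath G μ)) := by
          by_cases hμ : μ = []
          · simp [hμ]
          · rcases PV_mul_SPath_eq_or (G := G) v hμ with h | h
            · have h2 := congrArg star h
              rw [star_mul, star_PV] at h2
              rw [Commute, SemiconjBy, ← mul_assoc, h, mul_assoc, h2]
            · have h2 := congrArg star h
              rw [star_mul, star_PV, star_zero] at h2
              rw [Commute, SemiconjBy, ← mul_assoc, h, mul_assoc, h2, zero_mul, mul_zero]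
        rw [star_SE_mul_SE]
        set p := SPath G μ * star (SPath G μ)
        set q := SPath G ν * star (SPath G ν)
        have h1 : p * PV G (G.r e) * q = q * PV G (G.r e) * p := by
          rw [← (hc _ μ).eq, mul_assoc, (ih ν).eq, ← mul_assoc, (hc _ ν).eq]
        calc SE G e * p * PV G (G.r e) * q * star (SE G e)
            = SE G e * (p * PV G (G.r e) * q) * star (SE G e) := by simp only [mul_assoc]
          _ = _ := by rw [h1]; simp only [mul_assoc]
      · rw [star_SE_mul_SE_of_ne _ _ hef, star_SE_mul_SE_of_ne _ _ (Ne.symm hef)]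
        simp

lemma commute_of_mem_diag {x y : GraphAlg G} (hx : x ∈ diag G) (hy : y ∈ diag G) :
    x * y = y * x := by
  have key : ∀ p ∈ pathProjections G, ∀ q ∈ pathProjections G, p * q = q * p := by
    intro p hp q hq
    rcases hp with ⟨v, rfl⟩ | ⟨μ, hμ, hμ', rfl⟩
    · exact commute_PV_pathProjections v hq
    · rcases hq with ⟨w, rfl⟩ | ⟨ν, -, -, rfl⟩
      · exact (commute_PV_pathProjections w (.inr ⟨μ, hμ, hμ', rfl⟩)).eq.symm
      · exact commute_SPath_mul_star μ ν
  have h1 : ∀ p ∈ pathProjections G, ∀ d ∈ diag G, d * p = p * d := fun p hp d hd =>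
    commute_diag (fun q hq => key q hq p hp)
      (fun q hq => by rw [star_pathProjection hp]; exact key q hq p hp) hd
  exact commute_diag (fun p hp => (h1 p hp y hy).symm)
    (fun p hp => (h1 p hp (star y) (star_mem hy)).symm) hx

lemma diag_le_core : diag G ≤ core G := by
  refine StarSubalgebra.topologicalClosure_minimal (StarAlgebra.adjoin_le fun p hp => ?_) ?_
  · rcases hp with ⟨v, rfl⟩ | ⟨μ, -, -, rfl⟩
    · exact PV_mem_core v
    · rw [SetLike.mem_coe, mem_core_iff]
      simpa using isHomogeneous_monomial (G := G) μ μ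
  · have : (core G : Set (GraphAlg G)) = ⋂ z : Circle, {x | gauge G z x = x} := by
      ext x; simp [core]
    rw [this]
    exact isClosed_iInter fun z => isClosed_eq (continuous_starAlgHom _) continuous_id

/-- Only the summand of `e` survives. This intertwining relation underlies all later commutations
with the shift. -/
lemma shift_mul_SE {x : GraphAlg G} (hx : ∀ v, Commute (PV G v) x) (e : E) :
    shift G x * SE G e = SE G e * x := by
  rw [shift, Finset.sum_mul, Finset.sum_eq_single_of_mem e (Finset.mem_univ _)]
  · rw [mul_assoc, star_SE_mul_SE, mul_assoc, ← (hx _).eq, ← mul_assoc, SE_mul_PV_range]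
  · intro f _ hf
    rw [mul_assoc, star_SE_mul_SE_of_ne _ _ hf, mul_zero]

lemma star_SE_mul_shift {x : GraphAlg G} (hx : ∀ v, Commute (PV G v) x) (e : E) :
    star (SE G e) * shift G x = x * star (SE G e) := by
  have := congrArg star (shift_mul_SE (x := star x)
    (fun v => by have := (hx v).star_star; rwa [star_PV] at this) e)
  rwa [star_mul, star_mul, star_star, ← shift_star, star_star] at this

lemma commute_PV_of_mem_diag {x : GraphAlg G} (hx : x ∈ diag G) (v : V) :
    Commute (PV G v) x := commute_of_mem_diag (PV_mem_diag v) hx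

lemma iterate_shift_mem_diag {x : GraphAlg G} (hx : x ∈ diag G) (m : ℕ) :
    (shift G)^[m] x ∈ diag G := by
  induction m with
  | zero => exact hx
  | succ m ih => rw [Function.iterate_succ_apply']; exact shift_mem_diag ih

/-- The `m`-th iterate of the shift maps the diagonal into the commutant of the span of the
products `S_μ S_ν^*` with `|μ| = |ν| = m`. -/
lemma iterate_shift_commute {x : GraphAlg G} (hx : x ∈ diag G) {m : ℕ} {a : GraphAlg G}
    (ha : a ∈ homSpace G 0 m) : (shift G)^[m] x * a = a * (shift G)^[m] x := by
  have : homSpace G 0 m ≤ Subalgebra.toSubmodule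
      (Subalgebra.centralizer ℂ {(shift G)^[m] x}) := by
    clear ha
    induction m with
    | zero =>
      refine homSpace_zero_le fun v w ρ hρ => ?_
      rw [List.length_eq_zero_iff.1 hρ, SPath_nil, mul_one]
      rintro _ rfl
      exact (((commute_PV_of_mem_diag hx v).mul_left (commute_PV_of_mem_diag hx w)).eq).symm
    | succ m ih =>
      refine homSpace_succ_le fun e f a ha => ?_
      rintro _ rfl
      rw [Function.iterate_succ_apply']
      have h1 := ih ha _ rfl
      have hc := commute_PV_of_mem_diag (iterate_shift_mem_diag hx m)
      set y := (shift G)^[m] x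
      change y * a = a * y at h1
      -- The shift of `y` turns into `y` on passing `S_e`, commutes with `a` by induction, and turns
      -- back into the shift on passing `S_f^*`.
      calc shift G y * (SE G e * a * star (SE G f))
          = SE G e * (y * a) * star (SE G f) := by
            rw [← mul_assoc, ← mul_assoc, shift_mul_SE hc]; simp only [mul_assoc]
        _ = SE G e * a * (y * star (SE G f)) := by rw [h1]; simp only [mul_assoc]
        _ = _ := by rw [← star_SE_mul_shift hc]; simp only [mul_assoc]
  exact this ha _ rfl

/-! ## A representation in which the vertex projections do not vanish -/

section PartialPermutation

variable {ι : Type*}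

open scoped ENNReal lp

/-- Injectivity of `f` on its domain means that distinct indices contribute distinct coordinates of
`x`. -/
lemma sum_option_elim_le (f : ι ≃. ι) (x : ℓ²(ι, ℂ)) (s : Finset ι) :
    ∑ i ∈ s, ‖(f i).elim 0 x‖ ^ (2 : ℝ≥0∞).toReal ≤ ‖x‖ ^ (2 : ℝ≥0∞).toReal := by
  classical
  have h1 : ∑ i ∈ s, ‖(f i).elim 0 x‖ ^ (2 : ℝ≥0∞).toReal =
      ∑ i ∈ s with (f i).isSome, ‖x ((f i).getD i)‖ ^ (2 : ℝ≥0∞).toReal := by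
    rw [Finset.sum_filter]
    refine Finset.sum_congr rfl fun i _ => ?_
    rcases h : f i with _ | j <;> simp
  rw [h1, ← Finset.sum_image (f := fun j => ‖x j‖ ^ (2 : ℝ≥0∞).toReal)]
  · exact lp.sum_rpow_le_norm_rpow (by simp) x _
  · intro i hi j hj hij
    simp only [Finset.coe_filter, Set.mem_ofPred_eq, Option.isSome_iff_exists] at hi hj
    obtain ⟨-, a, ha⟩ := hi
    obtain ⟨-, b, hb⟩ := hj
    simp only [ha, hb, Option.getD_some] at hij
    subst hij
    exact f.inj ha hb

/-- The operator `x ↦ x ∘ f` on `ℓ²` of a partial permutation `f`, where `x ∘ f` vanishes outside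
of the domain of `f`. -/
def partialPermOp (f : ι ≃. ι) : ℓ²(ι, ℂ) →L[ℂ] ℓ²(ι, ℂ) :=
  LinearMap.mkContinuous
    { toFun := fun x => ⟨fun i => (f i).elim 0 x, memℓp_gen' (sum_option_elim_le f x)⟩
      map_add' := fun x y => by
        ext i
        change (f i).elim 0 (x + y) = (f i).elim 0 x + (f i).elim 0 y
        rcases f i with _ | j
        · exact (add_zero (0 : ℂ)).symm
        · rfl
      map_smul' := fun c x => by
        ext i
        change (f i).elim 0 (c • x) = c • (f i).elim 0 x
        rcases f i <;> simp }
    1 fun x => by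
      rw [one_mul]
      exact lp.norm_le_of_forall_sum_le (by simp) (norm_nonneg _) (sum_option_elim_le f x)

lemma partialPermOp_apply (f : ι ≃. ι) (x : ℓ²(ι, ℂ)) (i : ι) :
    partialPermOp f x i = (f i).elim 0 x := rfl

lemma star_partialPermOp (f : ι ≃. ι) : star (partialPermOp f) = partialPermOp f.symm := by
  rw [ContinuousLinearMap.star_eq_adjoint]
  refine ((ContinuousLinearMap.eq_adjoint_iff _ _).2 fun x y => ?_).symm
  rw [lp.inner_eq_tsum, lp.inner_eq_tsum]
  simp only [partialPermOp_apply]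
  refine tsum_eq_tsum_of_ne_zero_bij (fun j => (f j).getD j) ?_ ?_ ?_
  · rintro ⟨i, hi⟩ ⟨j, hj⟩ hij
    rcases hfi : f i with _ | a
    · simp [hfi] at hi
    rcases hfj : f j with _ | b
    · simp [hfj] at hj
    simp only [hfi, hfj, Option.getD_some] at hij
    subst hij
    exact Subtype.ext (f.inj hfi hfj)
  · intro i hi
    rcases hfi : f.symm i with _ | j
    · simp [hfi] at hi
    have hfj : f j = some i := (PEquiv.eq_some_iff f).1 hfi
    refine ⟨⟨j, ?_⟩, by simp [hfj]⟩
    simpa [hfi, hfj] using hi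
  · rintro ⟨j, hj⟩
    rcases hfj : f j with _ | b
    · simp [hfj] at hj
    have hfb : f.symm b = some j := (PEquiv.eq_some_iff f).2 hfj
    simp [hfb]

lemma partialPermOp_ext {S T : ℓ²(ι, ℂ) →L[ℂ] ℓ²(ι, ℂ)} (h : ∀ x i, S x i = T x i) : S = T :=
  ContinuousLinearMap.ext fun x => lp.ext (funext (h x))

end PartialPermutation

variable (G) in
/-- A bijection that realizes the edges as partial permutations of `V × ℕ`. -/
lemma exists_branching (hG : G.NoSinks) :
    ∃ σ : E × ℕ ≃ V × ℕ, ∀ e n, (σ (e, n)).1 = G.s e := by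
  -- Since `v` emits an edge, the edges leaving `v` times `ℕ` form a countably infinite set, which
  -- can be matched with the row `{v} × ℕ`.
  have h (v : V) : Nonempty ({e // G.s e = v} × ℕ ≃ ℕ) := by
    obtain ⟨e, he⟩ := hG v
    have : Nonempty {e // G.s e = v} := ⟨⟨e, he⟩⟩
    exact nonempty_equiv_of_countable
  exact ⟨(Equiv.prodCongr (Equiv.sigmaFiberEquiv G.s).symm (Equiv.refl ℕ)).trans <|
    (Equiv.sigmaProdDistrib _ ℕ).trans <|
    (Equiv.sigmaCongrRight fun v => (h v).some).trans (Equiv.sigmaEquivProd V ℕ), fun e n => rfl⟩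

open Classical in
/-- The partial permutation of `V × ℕ` that belongs to an edge. -/
def edgePartialPerm (G : DirectedGraph V E) (σ : E × ℕ ≃ V × ℕ) (e : E) : V × ℕ ≃. V × ℕ where
  toFun i := if (σ.symm i).1 = e then some (G.r e, (σ.symm i).2) else none
  invFun j := if j.1 = G.r e then some (σ (e, j.2)) else none
  inv i j := by
    obtain ⟨⟨f, n⟩, rfl⟩ := σ.surjective i
    obtain ⟨w, m⟩ := j
    by_cases h : w = G.r e
    · by_cases h' : f = e
      · subst h h'; simp [eq_comm]
      · simp [h, h', Ne.symm h']
    · simp [h, Ne.symm h]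

open Classical in
lemma edgePartialPerm_apply (σ : E × ℕ ≃ V × ℕ) (e : E) (i : V × ℕ) :
    edgePartialPerm G σ e i = if (σ.symm i).1 = e then some (G.r e, (σ.symm i).2) else none := rfl

open Classical in
lemma edgePartialPerm_symm_apply (σ : E × ℕ ≃ V × ℕ) (e : E) (j : V × ℕ) :
    (edgePartialPerm G σ e).symm j = if j.1 = G.r e then some (σ (e, j.2)) else none := rfl

open Classical in
lemma ofSet_vertex_apply (v : V) (i : V × ℕ) :
    PEquiv.ofSet {i : V × ℕ | i.1 = v} i = if i.1 = v then some i else none := rfl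

open Classical in
/-- The Cuntz-Krieger family on `ℓ²(V × ℕ)` that belongs to a bijection `E × ℕ ≃ V × ℕ`. -/
def branchingFamily (σ : E × ℕ ≃ V × ℕ) (hσ : ∀ e n, (σ (e, n)).1 = G.s e) :
    CKFamily G (lp (fun _ : V × ℕ => ℂ) 2 →L[ℂ] lp (fun _ : V × ℕ => ℂ) 2) where
  P v := partialPermOp (PEquiv.ofSet {i | i.1 = v})
  S e := partialPermOp (edgePartialPerm G σ e)
  star_P v := by rw [star_partialPermOp]; rfl
  P_mul_P v := partialPermOp_ext fun x i => by
    by_cases h : i.1 = v <;>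
      simp [partialPermOp_apply, ofSet_vertex_apply, h]
  P_orth v w h := partialPermOp_ext fun x i => by
    by_cases h' : i.1 = v <;>
      simp [partialPermOp_apply, ofSet_vertex_apply, h', h]
  sum_P := partialPermOp_ext fun x i => by
    simp only [sum_apply, lp.coeFn_sum, Finset.sum_apply, partialPermOp_apply,
      ofSet_vertex_apply]
    rw [Finset.sum_eq_single_of_mem i.1 (Finset.mem_univ _)]
    · simp
    · intro v _ hv
      simp [Ne.symm hv]
  star_S_mul_S e := partialPermOp_ext fun x i => by
    by_cases h : i.1 = G.r e <;>
      simp [star_partialPermOp, partialPermOp_apply, ofSet_vertex_apply, edgePartialPerm_apply,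
        edgePartialPerm_symm_apply, h]
    rw [← h]
  S_orth e f h := partialPermOp_ext fun x i => by
    by_cases h' : i.1 = G.r e <;>
      simp [star_partialPermOp, partialPermOp_apply, edgePartialPerm_apply,
        edgePartialPerm_symm_apply, h', h]
  range_le e := partialPermOp_ext fun x i => by
    obtain ⟨⟨f, n⟩, rfl⟩ := σ.surjective i
    by_cases h : f = e <;> by_cases h' : G.s f = G.s e <;>
      simp_all [star_partialPermOp, partialPermOp_apply, ofSet_vertex_apply,
        edgePartialPerm_apply, edgePartialPerm_symm_apply]
  sum_range v _ := partialPermOp_ext fun x i => by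
    obtain ⟨⟨f, n⟩, rfl⟩ := σ.surjective i
    have key (e : E) : partialPermOp (edgePartialPerm G σ e)
        (partialPermOp (edgePartialPerm G σ e).symm x) (σ (f, n)) =
          if f = e then x (σ (f, n)) else 0 := by
      by_cases h : f = e <;>
        simp [partialPermOp_apply, edgePartialPerm_apply, edgePartialPerm_symm_apply, h]
    simp only [sum_apply, lp.coeFn_sum, Finset.sum_apply, star_partialPermOp,
      mul_apply_eq_comp, key]
    rw [Finset.sum_ite_eq]
    by_cases h : G.s f = v <;> simp [partialPermOp_apply, ofSet_vertex_apply, hσ, h]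

/-- In the branching representation on `ℓ²(V × ℕ)` this projection fixes the basis vector at `(v,
0)`. Lower norm bounds for path isometries and nontriviality of the algebra rest on it. -/
lemma PV_ne_zero (hG : G.NoSinks) (v : V) : PV G v ≠ 0 := by
  classical
  obtain ⟨σ, hσ⟩ := exists_branching G hG
  intro h
  have h1 := (branchingFamily σ hσ).lift_P v
  rw [h, map_zero] at h1
  have h2 := congrArg (fun T => T (lp.single 2 (v, 0) (1 : ℂ)) (v, 0)) h1
  simp [branchingFamily, partialPermOp_apply, PEquiv.ofSet] at h2

/-! ## Relations between paths -/

lemma mul_star_mul_self_eq {A : Type*} [CStarAlgebra A] {a : A}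
    (h : star a * a * (star a * a) = star a * a) : a * (star a * a) = a := by
  have h1 : star (a - a * (star a * a)) * (a - a * (star a * a)) = 0 := by
    have h2 : star (a - a * (star a * a)) = star a - star a * a * star a := by
      simp [star_sub, star_mul, mul_assoc]
    calc star (a - a * (star a * a)) * (a - a * (star a * a))
        = star a * a - star a * a * (star a * a) - star a * a * (star a * a)
          + star a * a * (star a * a) * (star a * a) := by rw [h2]; noncomm_ring
      _ = 0 := by rw [h, h]; abel
  exact (sub_eq_zero.1 (CStarRing.star_mul_self_eq_zero_iff _ |>.1 h1)).symm

lemma SE_mul_star_mul_SE (e : E) : SE G e * star (SE G e) * SE G e = SE G e := by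
  rw [mul_assoc, star_SE_mul_SE, SE_mul_PV_range]

lemma star_SPath_mul_SPath {μ : List E} (hμ : G.IsPath μ) (h : μ ≠ []) :
    star (SPath G μ) * SPath G μ = PV G (G.r (μ.getLast h)) := by
  induction μ with
  | nil => exact absurd rfl h
  | cons e μ ih =>
    rcases μ with _ | ⟨f, μ⟩
    · simp [SPath_singleton, star_SE_mul_SE]
    · obtain ⟨hef, hμ'⟩ := List.isChain_cons_cons.1 hμ
      have h1 : PV G (G.r e) * SPath G (f :: μ) = SPath G (f :: μ) := by
        rw [SPath_cons, ← mul_assoc, hef, PV_source_mul_SE]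
      rw [SPath_cons, star_mul, mul_assoc, ← mul_assoc (star (SE G e)), star_SE_mul_SE, h1,
        ih hμ' (List.cons_ne_nil _ _), List.getLast_cons (List.cons_ne_nil _ _)]

lemma SPath_mul_star_mul_SPath {μ : List E} (hμ : G.IsPath μ) (h : μ ≠ []) :
    SPath G μ * star (SPath G μ) * SPath G μ = SPath G μ := by
  rw [mul_assoc]
  exact mul_star_mul_self_eq (by rw [star_SPath_mul_SPath hμ h, PV_mul_self])

lemma PV_mul_SPath {μ : List E} (h : μ ≠ []) :
    PV G (G.s (μ.head h)) * SPath G μ = SPath G μ := by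
  obtain ⟨e, μ, rfl⟩ := List.exists_cons_of_ne_nil h
  rw [SPath_cons, ← mul_assoc, List.head_cons, PV_source_mul_SE]

lemma PV_mul_SPath_of_ne {μ : List E} (h : μ ≠ []) {v : V} (hv : G.s (μ.head h) ≠ v) :
    PV G v * SPath G μ = 0 := by
  rw [← PV_mul_SPath h, ← mul_assoc, PV_mul_PV _ _ hv.symm, zero_mul]

/-- Path isometries of paths that branch off each other have orthogonal ranges. -/
lemma star_SPath_mul_SPath_of_branch {κ μ ν : List E} {e f : E} (h : e ≠ f) :
    star (SPath G (κ ++ e :: μ)) * SPath G (κ ++ f :: ν) = 0 := by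
  induction κ with
  | nil =>
    rw [List.nil_append, List.nil_append, SPath_cons, SPath_cons, star_mul, mul_assoc,
      ← mul_assoc (star (SE G e)), star_SE_mul_SE_of_ne _ _ h, zero_mul, mul_zero]
  | cons g κ ih =>
    have hne : κ ++ f :: ν ≠ [] := by simp
    rw [List.cons_append, List.cons_append, SPath_cons, SPath_cons, star_mul, mul_assoc,
      ← mul_assoc (star (SE G g)), star_SE_mul_SE]
    rcases PV_mul_SPath_eq_or (G := G) (G.r g) hne with h' | h' <;> rw [h']
    · exact ih
    · exact mul_zero _

lemma star_SPath_mul_SPath_of_ne {μ ν : List E} (hl : μ.length = ν.length) (h : μ ≠ ν) :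
    star (SPath G μ) * SPath G ν = 0 := by
  induction μ generalizing ν with
  | nil => exact absurd (List.length_eq_zero_iff.1 hl.symm).symm h
  | cons e μ ih =>
    rcases ν with _ | ⟨f, ν⟩
    · simp at hl
    · by_cases hef : e = f
      · subst hef
        have hμν : μ ≠ ν := fun h' => h (by rw [h'])
        have hl' : μ.length = ν.length := by simpa using hl
        have hν : ν ≠ [] := by
          rintro rfl
          exact hμν (List.length_eq_zero_iff.1 hl')
        rw [SPath_cons, SPath_cons, star_mul, mul_assoc, ← mul_assoc (star (SE G e)),
          star_SE_mul_SE]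
        rcases PV_mul_SPath_eq_or (G := G) (G.r e) hν with h' | h' <;> rw [h']
        · exact ih hl' hμν
        · exact mul_zero _
      · exact star_SPath_mul_SPath_of_branch (κ := []) hef

lemma one_le_norm_of_projection {A : Type*} [CStarAlgebra A] {p : A} (hs : star p = p)
    (hp : p * p = p) (h0 : p ≠ 0) : 1 ≤ ‖p‖ := by
  have h := CStarRing.norm_star_mul_self (x := p)
  rw [hs, hp] at h
  have := norm_pos_iff.2 h0
  nlinarith

lemma one_le_norm_SPath (hG : G.NoSinks) {μ : List E} (hμ : G.IsPath μ) (h : μ ≠ []) :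
    1 ≤ ‖SPath G μ‖ := by
  have h1 := one_le_norm_of_projection (star_PV (G := G) (G.r (μ.getLast h))) (PV_mul_self _)
    (PV_ne_zero hG _)
  rw [← star_SPath_mul_SPath hμ h, CStarRing.norm_star_mul_self] at h1
  nlinarith [norm_nonneg (SPath G μ)]

/-! ## The relative commutant of the diagonal -/

/-- A self-adjoint `h` has a spectral value `c` with `|c| = ‖h‖`. If every `p i * h` had smaller
norm, all `c - p i * h` would be invertible, and their inverses, cut down by the `p i` and added,
would invert `c - h`. -/
lemma exists_norm_le_norm_mul {A : Type*} [CStarAlgebra A] [Nontrivial A] {ι : Type*} [Fintype ι]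
    {p : ι → A} (hp : ∀ i, p i * p i = p i) (hsum : ∑ i, p i = 1) {h : A} (hh : IsSelfAdjoint h)
    (hc : ∀ i, p i * h = h * p i) : ∃ i, ‖h‖ ≤ ‖p i * h‖ := by
  by_contra! hlt
  obtain ⟨c, hc1, hc2⟩ := spectrum.exists_nnnorm_eq_spectralRadius h
  rw [hh.spectralRadius_eq_nnnorm, ENNReal.coe_inj] at hc2
  have hcn : ‖c‖ = ‖h‖ := congrArg NNReal.toReal hc2
  have hu (i : ι) : IsUnit (algebraMap ℂ A c - p i * h) :=
    spectrum.mem_resolventSet_iff.1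
      (spectrum.mem_resolventSet_of_norm_lt (by rw [hcn]; exact hlt i))
  have hp' (i : ι) : p i * (algebraMap ℂ A c - h) = p i * (algebraMap ℂ A c - p i * h) := by
    rw [mul_sub, mul_sub, ← mul_assoc (p i) (p i), hp]
  have hpc (i : ι) : p i * (algebraMap ℂ A c - h) = (algebraMap ℂ A c - h) * p i := by
    rw [mul_sub, sub_mul, hc, Algebra.commutes]
  have hpc' (i : ι) : p i * (algebraMap ℂ A c - p i * h) =
      (algebraMap ℂ A c - p i * h) * p i := by
    rw [mul_sub, sub_mul, mul_assoc (p i) h, ← hc, Algebra.commutes]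
  choose w hw using hu
  have hr : (algebraMap ℂ A c - h) * ∑ i, p i * ↑(w i)⁻¹ = 1 := by
    rw [Finset.mul_sum, ← hsum]
    refine Finset.sum_congr rfl fun i _ => ?_
    rw [← mul_assoc, ← hpc, hp', ← hw, mul_assoc, Units.mul_inv, mul_one]
  have hl : (∑ i, ↑(w i)⁻¹ * p i) * (algebraMap ℂ A c - h) = 1 := by
    rw [Finset.sum_mul, ← hsum]
    refine Finset.sum_congr rfl fun i _ => ?_
    rw [mul_assoc, hp', hpc', ← hw, ← mul_assoc, Units.inv_mul, one_mul]
  have : IsUnit (algebraMap ℂ A c - h) :=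
    isUnit_iff_exists_and_exists.2 ⟨⟨_, hr⟩, ⟨_, hl⟩⟩
  exact spectrum.mem_iff.1 hc1 this

variable (G) in
/-- The property of commuting with the diagonal. -/
def CommutesWithDiag (x : GraphAlg G) : Prop := ∀ d ∈ diag G, d * x = x * d

lemma CommutesWithDiag.adjoint {x : GraphAlg G} (hx : CommutesWithDiag G x) :
    CommutesWithDiag G (star x) := fun d hd => by
  have := congrArg star (hx (star d) (star_mem hd))
  simpa using this.symm

/-- Moving `d` past `S_e^*` turns it into its shift, which is still diagonal and commutes with `x`;
moving it past `S_e` turns it back. Compressions can therefore be iterated. -/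
lemma CommutesWithDiag.compress {x : GraphAlg G} (hx : CommutesWithDiag G x) (e : E) :
    CommutesWithDiag G (star (SE G e) * x * SE G e) := fun d hd => by
  have hc := commute_PV_of_mem_diag hd
  rw [← mul_assoc, ← mul_assoc, ← star_SE_mul_shift hc, mul_assoc (star (SE G e)),
    hx _ (shift_mem_diag hd), mul_assoc _ (SE G e) d, ← shift_mul_SE hc]
  simp only [mul_assoc]

/-- The range projections `S_e S_e^*` sum to one and commute with `x^* x`, so one of them carries
its full norm. On that range, `x^* x` is `S_e (y^* y) S_e^*` with `y` the compression of `x`. -/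
lemma CommutesWithDiag.exists_norm_le [Nontrivial (GraphAlg G)] (hG : G.NoSinks) {x : GraphAlg G}
    (hx : CommutesWithDiag G x) : ∃ e, ‖x‖ ≤ ‖star (SE G e) * x * SE G e‖ := by
  have hxs := hx.adjoint
  obtain ⟨e, he⟩ := exists_norm_le_norm_mul (p := fun e => SE G e * star (SE G e))
    (fun e => by rw [← mul_assoc, SE_mul_star_mul_SE]) (sum_SE_mul_star hG)
    (IsSelfAdjoint.star_mul_self x) fun e => by
      rw [← mul_assoc, hxs _ (range_mem_diag e), mul_assoc, hx _ (range_mem_diag e), mul_assoc]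
  refine ⟨e, ?_⟩
  set y := star (SE G e) * x * SE G e
  have h1 : SE G e * star (SE G e) * (star x * x) = SE G e * (star y * y) * star (SE G e) := by
    set p := SE G e * star (SE G e) with hp
    have hpp : p * p = p := by rw [hp, ← mul_assoc, SE_mul_star_mul_SE]
    have h2 : SE G e * (star y * y) * star (SE G e) = p * star x * p * x * p := by
      simp only [y, hp, star_mul, star_star, mul_assoc]
    rw [h2, mul_assoc _ x p, ← hx _ (range_mem_diag e), ← hp, mul_assoc (p * star x),
      ← mul_assoc p p x, hpp, hxs _ (range_mem_diag e), ← hp, mul_assoc (star x) p (p * x),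
      ← mul_assoc p p x, hpp, ← mul_assoc, hxs _ (range_mem_diag e), mul_assoc]
  have h2 : ‖star x * x‖ ≤ ‖star y * y‖ := by
    refine he.trans ?_
    rw [h1]
    calc ‖SE G e * (star y * y) * star (SE G e)‖
        ≤ ‖SE G e‖ * ‖star y * y‖ * ‖star (SE G e)‖ :=
          (norm_mul_le _ _).trans (by gcongr; exact norm_mul_le _ _)
      _ ≤ 1 * ‖star y * y‖ * 1 := by
          rw [norm_star]; gcongr <;> exact norm_SE_le e
      _ = _ := by ring
  rw [CStarRing.norm_star_mul_self, CStarRing.norm_star_mul_self] at h2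
  exact (mul_self_le_mul_self_iff (norm_nonneg x) (norm_nonneg y)).2 h2

lemma CommutesWithDiag.exists_norm_le_SPath [Nontrivial (GraphAlg G)] (hG : G.NoSinks) (n : ℕ)
    {x : GraphAlg G} (hx : CommutesWithDiag G x) :
    ∃ μ : List E, μ.length = n ∧ CommutesWithDiag G (star (SPath G μ) * x * SPath G μ) ∧
      ‖x‖ ≤ ‖star (SPath G μ) * x * SPath G μ‖ := by
  induction n generalizing x with
  | zero => exact ⟨[], rfl, by simpa using hx, by simp⟩
  | succ n ih =>
    obtain ⟨e, he⟩ := hx.exists_norm_le hG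
    obtain ⟨μ, hμ, hc, hn⟩ := ih (hx.compress e)
    have h : star (SPath G (e :: μ)) * x * SPath G (e :: μ) =
        star (SPath G μ) * (star (SE G e) * x * SE G e) * SPath G μ := by
      rw [SPath_cons, star_mul]; simp only [mul_assoc]
    exact ⟨e :: μ, by simp [hμ], by rwa [h], by rw [h]; exact he.trans hn⟩

lemma norm_compress_le (e : E) (x : GraphAlg G) : ‖star (SE G e) * x * SE G e‖ ≤ ‖x‖ :=
  calc ‖star (SE G e) * x * SE G e‖ ≤ ‖star (SE G e)‖ * ‖x‖ * ‖SE G e‖ :=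
        (norm_mul_le _ _).trans (by gcongr; exact norm_mul_le _ _)
    _ ≤ 1 * ‖x‖ * 1 := by rw [norm_star]; gcongr <;> exact norm_SE_le e
    _ = ‖x‖ := by ring

/-- Each compression strips one sandwich off the approximant; a suitable edge keeps the norm of `x`
from dropping, and the error never grows. -/
lemma CommutesWithDiag.exists_homSpace_zero [Nontrivial (GraphAlg G)] (hG : G.NoSinks)
    {k m : ℕ} {x b : GraphAlg G} (hx : CommutesWithDiag G x) (hb : b ∈ homSpace G k m) :
    ∃ y, CommutesWithDiag G y ∧ ‖x‖ ≤ ‖y‖ ∧ ∃ c ∈ homSpace G k 0, ‖y - c‖ ≤ ‖x - b‖ := by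
  induction m generalizing x b with
  | zero => exact ⟨x, hx, le_rfl, b, hb, le_rfl⟩
  | succ m ih =>
    obtain ⟨e, he⟩ := hx.exists_norm_le hG
    obtain ⟨y, hy, hxy, c, hc, hyc⟩ := ih (hx.compress e) (compress_mem_homSpace e hb)
    refine ⟨y, hy, he.trans hxy, c, hc, hyc.trans ?_⟩
    rw [← sub_mul, ← mul_sub]
    exact norm_compress_le e _

/-- Distinct paths of equal length have orthogonal ranges, so only the term of `ρ` itself survives.
-/
lemma compress_homSpace_zero {k : ℕ} (hk : k ≠ 0) {ρ : List E} (hρ : ρ.length = k)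
    {b : GraphAlg G} (hb : b ∈ homSpace G k 0) :
    ∃ c : ℂ, star (SPath G ρ) * b * SPath G ρ =
      c • (star (SPath G ρ) * SPath G ρ * SPath G ρ) := by
  have hle : homSpace G k 0 ≤ (ℂ ∙ (star (SPath G ρ) * SPath G ρ * SPath G ρ)).comap
      (LinearMap.mulRight ℂ (SPath G ρ) ∘ₗ LinearMap.mulLeft ℂ (star (SPath G ρ))) := by
    refine homSpace_zero_le fun v w ν hν => ?_
    change star (SPath G ρ) * (PV G v * SPath G ν * PV G w) * SPath G ρ ∈
      ℂ ∙ (star (SPath G ρ) * SPath G ρ * SPath G ρ)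
    have hν0 : ν ≠ [] := by rintro rfl; exact hk hν.symm
    have hρ0 : ρ ≠ [] := by rintro rfl; exact hk hρ.symm
    have h1 : star (SPath G ρ) * (PV G v * SPath G ν * PV G w) * SPath G ρ =
        star (SPath G ρ) * (PV G v * SPath G ν) * (PV G w * SPath G ρ) := by
      simp only [mul_assoc]
    rw [h1]
    rcases PV_mul_SPath_eq_or (G := G) v hν0 with h | h <;> rw [h]
    · rcases PV_mul_SPath_eq_or (G := G) w hρ0 with h | h <;> rw [h]
      · by_cases hne : ρ = ν
        · subst hne; exact Submodule.mem_span_singleton_self _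
        · rw [star_SPath_mul_SPath_of_ne (hρ.trans hν.symm) hne, zero_mul]; exact zero_mem _
      · rw [mul_zero]; exact zero_mem _
    · rw [mul_zero, zero_mul]; exact zero_mem _
  obtain ⟨c, hc⟩ := Submodule.mem_span_singleton.1 (hle hb)
  exact ⟨c, hc.symm⟩

/-- A loop with an exit has a path that branches off the loop. -/
lemma exists_branch {ρ : List E} (hρ : G.IsLoop ρ) (hexit : G.HasExit ρ) :
    ∃ τ : List E, G.IsPath (ρ ++ τ) ∧ τ ≠ [] ∧ star (SPath G τ) * SPath G ρ = 0 := by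
  obtain ⟨e, he, f, g, hfg, hf, hg⟩ := hexit
  obtain ⟨f, hfe, hf⟩ : ∃ f, f ≠ e ∧ G.s f = G.s e := by
    by_cases h : f = e
    · exact ⟨g, fun h' => hfg (h.trans h'.symm), hg⟩
    · exact ⟨f, h, hf⟩
  obtain ⟨ρ₁, ρ₂, rfl⟩ := List.append_of_mem he
  obtain ⟨hp, hne, hl⟩ := hρ
  -- The path runs along the loop up to the source of `e` and then leaves through the other edge
  -- `f`.
  refine ⟨ρ₁ ++ [f], ?_, by simp, star_SPath_mul_SPath_of_branch hfe⟩
  have hp1 : G.IsPath (ρ₁ ++ [f]) := by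
    rw [DirectedGraph.IsPath, List.isChain_append] at hp ⊢
    refine ⟨hp.1, List.isChain_singleton _, fun x hx y hy => ?_⟩
    simp only [List.head?_cons, Option.mem_some_iff] at hy
    rw [← hy, hf]
    exact hp.2.2 x hx e rfl
  refine List.isChain_append.2 ⟨hp, hp1, fun x hx y hy => ?_⟩
  have hx' : x = (ρ₁ ++ e :: ρ₂).getLast hne := by
    rw [List.getLast?_eq_getLast_of_ne_nil hne] at hx
    simpa using hx.symm
  rw [hx', ← hl]
  rcases ρ₁ with _ | ⟨a, ρ₁⟩
  · simp only [List.nil_append, List.head?_cons, Option.mem_some_iff] at hy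
    simp [← hy, hf]
  · simp only [List.cons_append, List.head?_cons, Option.mem_some_iff] at hy
    simp [← hy]

/-- If every loop has an exit, there are no nonzero elements of positive degree that commute with
the diagonal. -/
lemma CommutesWithDiag.eq_zero (hG : G.NoSinks) (hexit : G.EveryLoopHasExit) {k : ℕ} (hk : k ≠ 0)
    {x : GraphAlg G} (hx : CommutesWithDiag G x) (hxk : IsHomogeneous G k x) : x = 0 := by
  rcases subsingleton_or_nontrivial (GraphAlg G) with _ | _
  · exact Subsingleton.elim _ _
  -- One `ε` accounts for the distance from the compression `z` of `x` to `c • t`, and two for the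
  -- norm of `c • t`.
  have key : ∀ ε > 0, ‖x‖ ≤ 3 * ε := by
    intro ε hε
    obtain ⟨m, b, hb, hxb⟩ := hxk.exists_homSpace hG hε
    obtain ⟨y, hy, hxy, b', hb', hyb⟩ := hx.exists_homSpace_zero hG hb
    obtain ⟨ρ, hρ, hy', hyy'⟩ := hy.exists_norm_le_SPath hG k
    obtain ⟨c, hc⟩ := compress_homSpace_zero hk hρ hb'
    have hρ0 : ρ ≠ [] := by rintro rfl; exact hk hρ.symm
    set z := star (SPath G ρ) * y * SPath G ρ
    set t := star (SPath G ρ) * SPath G ρ * SPath G ρ with ht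
    have hz : ‖z - c • t‖ ≤ ε := by
      rw [← hc, ← sub_mul, ← mul_sub]
      calc ‖star (SPath G ρ) * (y - b') * SPath G ρ‖
          ≤ ‖star (SPath G ρ)‖ * ‖y - b'‖ * ‖SPath G ρ‖ :=
            (norm_mul_le _ _).trans (by gcongr; exact norm_mul_le _ _)
        _ ≤ 1 * ‖y - b'‖ * 1 := by rw [norm_star]; gcongr <;> exact norm_SPath_le ρ
        _ ≤ ε := by rw [one_mul, mul_one]; exact hyb.trans hxb.le
    refine (hxy.trans hyy').trans ?_
    by_cases ht0 : t = 0
    · rw [ht0, smul_zero, sub_zero] at hz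
      linarith
    have hpath : G.IsPath ρ := by
      by_contra h
      exact ht0 (by rw [ht, SPath_eq_zero_of_not_isPath h, mul_zero])
    rw [star_SPath_mul_SPath hpath hρ0] at ht
    have hl : G.s (ρ.head hρ0) = G.r (ρ.getLast hρ0) := by
      by_contra h
      exact ht0 (by rw [ht, PV_mul_SPath_of_ne hρ0 h])
    -- As `ρ` closes up, `t` is just `S_ρ`.
    rw [← hl, PV_mul_SPath] at ht
    have hloop : G.IsLoop ρ := ⟨hpath, hρ0, hl⟩
    obtain ⟨τ, hτ, hτ0, hort⟩ := exists_branch hloop (hexit ρ hloop)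
    have hτp : G.IsPath τ := (List.isChain_append.1 hτ).2.1
    -- Since `z` commutes with the projection `S_τ S_τ^*` and `S_τ^* S_ρ = 0`, only the error `z - c
    -- • t` contributes.
    have h1 : z * SPath G τ = SPath G τ * (star (SPath G τ) * (z - c • t) * SPath G τ) := by
      calc z * SPath G τ = z * (SPath G τ * star (SPath G τ)) * SPath G τ := by
            rw [mul_assoc z, SPath_mul_star_mul_SPath hτp hτ0]
        _ = SPath G τ * (star (SPath G τ) * z * SPath G τ) := by
            rw [← hy' _ (SPath_mul_star_mem_diag hτ0)]; simp only [mul_assoc]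
        _ = _ := by rw [mul_sub, ht, mul_smul_comm, hort, smul_zero, sub_zero]
    have hτn := norm_SPath_le (G := G) τ
    have h2 : ‖z * SPath G τ‖ ≤ ε := by
      rw [h1]
      calc ‖SPath G τ * (star (SPath G τ) * (z - c • t) * SPath G τ)‖
          ≤ ‖SPath G τ‖ * (‖star (SPath G τ)‖ * ‖z - c • t‖ * ‖SPath G τ‖) :=
            (norm_mul_le _ _).trans (by
              gcongr; exact (norm_mul_le _ _).trans (by gcongr; exact norm_mul_le _ _))
        _ ≤ 1 * (1 * ε * 1) := by rw [norm_star]; gcongr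
        _ = ε := by ring
    have h3 : ‖(z - c • t) * SPath G τ‖ ≤ ε :=
      calc ‖(z - c • t) * SPath G τ‖ ≤ ‖z - c • t‖ * ‖SPath G τ‖ := norm_mul_le _ _
        _ ≤ ε * 1 := by gcongr
        _ = ε := mul_one ε
    -- On the other hand `c • S_{ρτ}` is a difference of two elements of norm at most `ε`, and
    -- `S_{ρτ}` has norm at least one because `ρτ` is a path.
    have h4 : ‖c‖ ≤ 2 * ε := by
      have h5 : c • SPath G (ρ ++ τ) = z * SPath G τ - (z - c • t) * SPath G τ := by
        rw [SPath_append, ht]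
        simp [sub_mul]
      have h6 : ‖c • SPath G (ρ ++ τ)‖ ≤ ε + ε := by
        rw [h5]; exact (norm_sub_le _ _).trans (add_le_add h2 h3)
      have h7 := one_le_norm_SPath hG hτ (by simp [hτ0])
      rw [norm_smul] at h6
      nlinarith [norm_nonneg c]
    have h8 : ‖c • t‖ ≤ 2 * ε := by
      rw [norm_smul, ht]
      nlinarith [norm_SPath_le (G := G) ρ, norm_nonneg c]
    have h9 := norm_add_le (z - c • t) (c • t)
    rw [sub_add_cancel] at h9
    linarith
  rw [← norm_le_zero_iff]
  refine le_of_forall_pos_le_add fun ε hε => ?_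
  have := key (ε / 3) (by positivity)
  linarith

/-- The relative commutant of the diagonal is contained in the core. -/
lemma CommutesWithDiag.mem_core (hG : G.NoSinks) (hexit : G.EveryLoopHasExit) {x : GraphAlg G}
    (hx : CommutesWithDiag G x) : x ∈ core G := by
  -- Diagonal elements have degree zero, so every spectral component inherits the commutation;
  -- negative degrees are then handled by adjoints.
  have hk (k : ℤ) : CommutesWithDiag G (spectralProj hG k x) := fun d hd => by
    rw [← spectralProj_mul_left hG k (diag_le_core hd), hx d hd,
      spectralProj_mul_right hG k (diag_le_core hd)]
  refine mem_core_iff.2 (isHomogeneous_of_spectralProj_eq_zero hG fun k hk0 => ?_)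
  have hh := isHomogeneous_spectralProj hG k x
  rcases le_total 0 k with h | h
  · lift k to ℕ using h
    exact (hk k).eq_zero hG hexit (by exact_mod_cast hk0) hh
  · obtain ⟨n, rfl⟩ : ∃ n : ℕ, k = -n := ⟨k.natAbs, by omega⟩
    have h1 := hh.adjoint
    rw [neg_neg] at h1
    exact star_eq_zero.1 ((hk _).adjoint.eq_zero hG hexit (by omega) h1)

/-! ## Automorphisms that fix the diagonal -/

lemma isHomogeneous_apply_of_comm {α : GraphAlg G ≃⋆ₐ[ℂ] GraphAlg G}
    (h : ∀ z x, gauge G z (α x) = α (gauge G z x)) {x : GraphAlg G} (hx : x ∈ core G) :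
    α x ∈ core G := fun z => by rw [h, hx z]

lemma gauge_apply_comm (hG : G.NoSinks) {α : GraphAlg G ≃⋆ₐ[ℂ] GraphAlg G}
    (h : ∀ e, IsHomogeneous G 1 (α (SE G e))) (z : Circle) (x : GraphAlg G) :
    gauge G z (α x) = α (gauge G z x) := by
  refine starAlgHom_eq_of_SE hG ((gauge G z).comp (α : GraphAlg G →⋆ₐ[ℂ] GraphAlg G))
    ((α : GraphAlg G →⋆ₐ[ℂ] GraphAlg G).comp (gauge G z)) (fun e => ?_) x
  have := h e z
  simpa using this

lemma compress_pathProjection_mem_diag (e : E) {p : GraphAlg G} (hp : p ∈ pathProjections G) :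
    star (SE G e) * p * SE G e ∈ diag G := by
  rcases hp with ⟨v, rfl⟩ | ⟨μ, hμ, -, rfl⟩
  · rw [mul_assoc]
    rcases PV_mul_SE_eq_or (G := G) v e with h | h <;> rw [h]
    · rw [star_SE_mul_SE]; exact PV_mem_diag _
    · rw [mul_zero]; exact zero_mem _
  · obtain ⟨f, μ, rfl⟩ := List.exists_cons_of_ne_nil hμ
    have h1 : SPath G (f :: μ) * star (SPath G (f :: μ)) =
        SE G f * (SPath G μ * star (SPath G μ)) * star (SE G f) := by
      rw [SPath_cons, star_mul]; simp only [mul_assoc]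
    rw [h1]
    rcases star_SE_mul_sandwich e f f e (SPath G μ * star (SPath G μ)) with h | h <;> rw [h]
    · exact zero_mem _
    · refine mul_mem (mul_mem (PV_mem_diag _) ?_) (PV_mem_diag _)
      by_cases hμ : μ = []
      · simp [hμ]
      · exact SPath_mul_star_mem_diag hμ

/-- For a path projection `p`, `p S_e = S_e q` with `q = S_e^* p S_e` diagonal and so fixed by `α`.
Thus `α(S_e) S_e^*` commutes with the diagonal and lies in the core, and multiplying by `S_e`
recovers `α(S_e)`. -/
lemma isHomogeneous_apply_of_mem_autFixing (hG : G.NoSinks) (hexit : G.EveryLoopHasExit)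
    {α : GraphAlg G ≃⋆ₐ[ℂ] GraphAlg G} (hα : α ∈ autFixing (diag G)) (e : E) :
    IsHomogeneous G 1 (α (SE G e)) := by
  have key : ∀ p ∈ pathProjections G, p * (α (SE G e) * star (SE G e)) =
      α (SE G e) * star (SE G e) * p := by
    intro p hp
    have hpd := pathProjections_subset hp
    have h1 : p * SE G e = SE G e * (star (SE G e) * p * SE G e) := by
      rw [← mul_assoc, ← mul_assoc, commute_of_mem_diag (range_mem_diag e) hpd, mul_assoc,
        SE_mul_star_mul_SE]
    have h2 : star (SE G e) * p = (star (SE G e) * p * SE G e) * star (SE G e) := by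
      have := congrArg star h1
      rw [star_mul, star_mul, star_mul, star_mul, star_star, star_pathProjection hp] at this
      simpa only [mul_assoc] using this
    have h3 : p * α (SE G e) = α (SE G e) * (star (SE G e) * p * SE G e) := by
      have := congrArg α h1
      rwa [map_mul, hα p hpd, map_mul, hα _ (compress_pathProjection_mem_diag e hp)] at this
    rw [← mul_assoc, h3, mul_assoc _ (star (SE G e)) p, mul_assoc _ _ (star (SE G e)), ← h2]
  have hc : CommutesWithDiag G (α (SE G e) * star (SE G e)) := fun d hd =>
    commute_diag key (fun p hp => by
      have := congrArg star (key p hp)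
      rw [star_mul, star_mul _ p, star_pathProjection hp] at this
      exact this.symm) hd
  have h1 : α (SE G e) = α (SE G e) * star (SE G e) * SE G e := by
    have h2 : α (SE G e) = α (SE G e) * PV G (G.r e) := by
      conv_lhs => rw [← SE_mul_PV_range, map_mul, hα _ (PV_mem_diag _)]
    rw [mul_assoc, star_SE_mul_SE, ← h2]
  rw [h1]
  simpa using (mem_core_iff.1 (hc.mem_core hG hexit)).mul (isHomogeneous_SE e)

/-- Automorphisms that fix the diagonal pointwise preserve the core. -/
lemma autFixing_le_autDiagCore (hG : G.NoSinks) (hexit : G.EveryLoopHasExit) :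
    autFixing (diag G) ≤ autDiagCore G := by
  have hcore : ∀ α ∈ autFixing (diag G), ∀ x ∈ core G, α x ∈ core G := fun α hα x hx =>
    isHomogeneous_apply_of_comm
      (gauge_apply_comm hG (isHomogeneous_apply_of_mem_autFixing hG hexit hα)) hx
  intro α hα
  refine ⟨?_, ?_⟩
  · change α '' _ = _
    rw [Set.image_congr (g := id) fun x hx => hα x hx, Set.image_id]
  · refine Set.Subset.antisymm (Set.image_subset_iff.2 (hcore α hα)) fun x hx => ?_
    exact ⟨α⁻¹ x, hcore _ (inv_mem hα) x hx, α.apply_symm_apply x⟩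

/-! ## A proper isometry of degree one -/

/-- Following chosen successor edges in a finite edge set must eventually repeat an edge. -/
lemma exists_isLoop [Nonempty V] (hG : G.NoSinks) : ∃ μ, G.IsLoop μ := by
  choose next hnext using fun e : E => hG (G.r e)
  obtain ⟨e₀, -⟩ := hG (Classical.arbitrary V)
  obtain ⟨i, -, j, -, hij, h⟩ := Set.infinite_univ.exists_lt_map_eq_of_mapsTo
    (f := fun n : ℕ => next^[n] e₀) (t := Set.univ) (fun _ _ => Set.mem_univ _) Set.finite_univ
  obtain ⟨n, rfl⟩ : ∃ n, j = n + 1 + i := ⟨j - i - 1, by omega⟩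
  set e := next^[i] e₀
  have hn : next^[n + 1] e = e := by
    rw [← Function.iterate_add_apply]; exact h.symm
  refine ⟨(List.range (n + 1)).map fun k => next^[k] e, ?_, by simp, ?_⟩
  · rw [DirectedGraph.IsPath, List.isChain_map, List.isChain_iff_getElem]
    intro k hk
    rw [List.getElem_range, List.getElem_range, Function.iterate_succ_apply', hnext]
  · rw [List.head_map, List.getLast_map, List.head_range, List.getLast_range,
      ← hnext, ← Function.iterate_succ_apply' next, Nat.add_sub_cancel, hn]
    rfl

variable (G) in
/-- The sum of the partial isometries `S_e`, where `e` runs over the edges chosen by `c`. -/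
def choiceIsometry (c : V → E) : GraphAlg G := ∑ v, SE G (c v)

lemma star_choiceIsometry_mul_self {c : V → E} (hc : ∀ v, G.r (c v) = v) :
    star (choiceIsometry G c) * choiceIsometry G c = 1 := by
  rw [choiceIsometry, star_sum, Finset.sum_mul, ← sum_PV]
  refine Finset.sum_congr rfl fun v _ => ?_
  rw [Finset.mul_sum, Finset.sum_eq_single_of_mem v (Finset.mem_univ _), star_SE_mul_SE, hc]
  intro w _ hw
  exact star_SE_mul_SE_of_ne _ _ fun h => hw (by rw [← hc v, h, hc])

/-- A unitary would force `c` to hit every edge. Then `G.s ∘ c` is a surjection of the finite vertex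
set, hence injective, so each vertex emits only one edge and no loop has an exit; yet a loop exists.
-/
lemma choiceIsometry_mul_star_ne_one [Nonempty V] (hG : G.NoSinks)
    (hexit : G.EveryLoopHasExit) (c : V → E) :
    choiceIsometry G c * star (choiceIsometry G c) ≠ 1 := by
  intro h
  have hsurj : Function.Surjective c := by
    intro f
    by_contra hf
    have h1 : star (choiceIsometry G c) * SE G f = 0 := by
      rw [choiceIsometry, star_sum, Finset.sum_mul]
      exact Finset.sum_eq_zero fun v _ => star_SE_mul_SE_of_ne _ _ fun h' => hf ⟨v, h'⟩
    have h2 : SE G f = 0 := by rw [← one_mul (SE G f), ← h, mul_assoc, h1, mul_zero]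
    exact PV_ne_zero hG (G.r f) (by rw [← star_SE_mul_SE, h2, mul_zero])
  have hsc : Function.Injective (G.s ∘ c) := Finite.injective_iff_surjective.2
    (Function.Surjective.comp (fun v => hG v) hsurj)
  obtain ⟨μ, hμ⟩ := exists_isLoop hG
  obtain ⟨e, -, f, g, hfg, hf, hg⟩ := hexit μ hμ
  obtain ⟨v, rfl⟩ := hsurj f
  obtain ⟨w, rfl⟩ := hsurj g
  exact hfg (congrArg c (hsc (hf.trans hg.symm)))

lemma isHomogeneous_choiceIsometry (c : V → E) : IsHomogeneous G 1 (choiceIsometry G c) :=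
  IsHomogeneous.sum fun v _ => isHomogeneous_SE (c v)

lemma star_choiceIsometry_mul_shift (c : V → E) {x : GraphAlg G}
    (hx : ∀ v, Commute (PV G v) x) :
    star (choiceIsometry G c) * shift G x = x * star (choiceIsometry G c) := by
  rw [choiceIsometry, star_sum, Finset.sum_mul, Finset.mul_sum]
  exact Finset.sum_congr rfl fun v _ => star_SE_mul_shift hx _

/-- Since the core is a finite algebra, proper isometries have positive degree as soon as there is
some isometry of degree one. -/
lemma degree_pos_of_isometry (hG : G.NoSinks) {u t : GraphAlg G} (hu : star u * u = 1)
    (hu1 : IsHomogeneous G 1 u) (ht : star t * t = 1) (ht' : t * star t ≠ 1) {k : ℤ}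
    (hk : IsHomogeneous G k t) : 0 < k := by
  by_contra! hk0
  obtain ⟨n, rfl⟩ : ∃ n : ℕ, k = -n := ⟨k.natAbs, by omega⟩
  have hun : star (u ^ n) * u ^ n = 1 := by
    clear hk hk0
    induction n with
    | zero => simp
    | succ n ih =>
      rw [pow_succ', star_mul, mul_assoc, ← mul_assoc (star u), hu, one_mul, ih]
  -- Multiplication by `u ^ n` raises the degree `-n` to zero, giving an isometry in the finite
  -- core, hence a unitary; cancelling `u ^ n` then makes `t` unitary.
  have hcore : u ^ n * t ∈ core G := by
    rw [mem_core_iff]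
    simpa using (hu1.pow n).mul hk
  have h1 : star t * star (u ^ n) * (u ^ n * t) = 1 := by
    calc star t * star (u ^ n) * (u ^ n * t) = star t * (star (u ^ n) * u ^ n) * t := by
          simp only [mul_assoc]
      _ = 1 := by rw [hun, mul_one, ht]
  have h2 := mul_eq_one_of_mem_core hG hcore h1
  refine ht' ?_
  calc t * star t = (star (u ^ n) * u ^ n) * (t * star t) * (star (u ^ n) * u ^ n) := by
        rw [hun, one_mul, mul_one]
    _ = star (u ^ n) * (u ^ n * t * (star t * star (u ^ n))) * u ^ n := by simp only [mul_assoc]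
    _ = 1 := by rw [h2, mul_one, hun]

/-! ## Automorphisms that preserve the core and the diagonal -/

/-- If the core has trivial center, its relative commutant is trivial. -/
lemma exists_eq_smul_one_of_commute_core (hG : G.NoSinks) (hexit : G.EveryLoopHasExit)
    (hcenter : Subalgebra.center ℂ (core G) = ⊥) {x : GraphAlg G}
    (hx : ∀ y ∈ core G, x * y = y * x) : ∃ c : ℂ, x = c • 1 := by
  have hxc : x ∈ core G := CommutesWithDiag.mem_core hG hexit fun d hd =>
    (hx d (diag_le_core hd)).symm
  have h : (⟨x, hxc⟩ : core G) ∈ Subalgebra.center ℂ (core G) :=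
    Subalgebra.mem_center_iff.2 fun y => Subtype.ext (hx y y.2).symm
  rw [hcenter, Algebra.mem_bot] at h
  obtain ⟨c, hc⟩ := h
  refine ⟨c, ?_⟩
  have := congrArg Subtype.val hc
  rw [← Algebra.algebraMap_eq_smul_one]
  exact this.symm

lemma apply_mem_core {α : GraphAlg G ≃⋆ₐ[ℂ] GraphAlg G} (hα : α ∈ autPreserving (core G))
    {x : GraphAlg G} (hx : x ∈ core G) : α x ∈ core G := apply_mem hα hx

lemma symm_apply_mem_core {α : GraphAlg G ≃⋆ₐ[ℂ] GraphAlg G} (hα : α ∈ autPreserving (core G))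
    {x : GraphAlg G} (hx : x ∈ core G) : α.symm x ∈ core G :=
  apply_mem (α := α⁻¹) (inv_mem hα) hx

/-- Automorphisms that preserve the core map a homogeneous isometry that implements an endomorphism
of the core to a homogeneous element. -/
lemma exists_isHomogeneous_apply [Nontrivial (GraphAlg G)] (hG : G.NoSinks)
    (hexit : G.EveryLoopHasExit) (hcenter : Subalgebra.center ℂ (core G) = ⊥)
    {α : GraphAlg G ≃⋆ₐ[ℂ] GraphAlg G} (hα : α ∈ autPreserving (core G)) {u : GraphAlg G} {j : ℤ}
    (hu : star u * u = 1) (hj : IsHomogeneous G j u) : ∃ k, IsHomogeneous G k (α u) := by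
  set t := α u with ht
  have htt : star t * t = 1 := by rw [ht, ← map_star, ← map_mul, hu, map_one]
  have hcore : ∀ y ∈ core G, t * y * star t ∈ core G := by
    intro y hy
    have h1 : u * α.symm y * star u ∈ core G := by
      rw [mem_core_iff]
      have := (hj.mul (mem_core_iff.1 (symm_apply_mem_core hα hy))).mul hj.adjoint
      simpa using this
    have h2 := apply_mem_core hα h1
    rwa [map_mul, map_mul, map_star, StarAlgEquiv.apply_symm_apply] at h2
  -- This is the degree-`k` part of `t y = (t y t^*) t`; both `y` and `t y t^*` have degree zero.
  have hinter (k : ℤ) : ∀ y ∈ core G,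
      spectralProj hG k t * y = t * y * star t * spectralProj hG k t := by
    intro y hy
    rw [← spectralProj_mul_right hG k hy, ← spectralProj_mul_left hG k (hcore y hy),
      mul_assoc _ (star t) t, htt, mul_one]
  have hk (k : ℤ) : ∃ c : ℂ, spectralProj hG k t = c • t := by
    obtain ⟨c, hc⟩ := exists_eq_smul_one_of_commute_core hG hexit hcenter
      (x := star t * spectralProj hG k t) fun y hy => by
        rw [mul_assoc, hinter k y hy, ← mul_assoc, ← mul_assoc, ← mul_assoc, htt, one_mul,
          mul_assoc]
    refine ⟨c, ?_⟩
    -- Taking `y = 1` shows that the component lies in the range of `t t^*`, so it is recovered from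
    -- the scalar `t^* t_k`.
    have h1 := hinter k 1 (one_mem _)
    rw [mul_one, mul_one, mul_assoc, hc, mul_smul_comm, mul_one] at h1
    exact h1
  -- If all components vanished, `t` would be homogeneous of degree zero, hence equal to its own
  -- zero component.
  have hne : ∃ k, spectralProj hG k t ≠ 0 := by
    by_contra! h
    have h1 := isHomogeneous_of_spectralProj_eq_zero hG (j := 0) (x := t) fun k _ => h k
    have h2 := spectralProj_of_isHomogeneous hG h1 0
    rw [h, if_pos rfl] at h2
    rw [← h2, mul_zero] at htt
    exact zero_ne_one htt
  obtain ⟨k, hkne⟩ := hne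
  obtain ⟨c, hc⟩ := hk k
  have hc0 : c ≠ 0 := by
    rintro rfl
    exact hkne (by rw [hc, zero_smul])
  refine ⟨k, fun z => ?_⟩
  have h1 : t = c⁻¹ • spectralProj hG k t := by rw [hc, smul_smul, inv_mul_cancel₀ hc0, one_smul]
  rw [h1, map_smul, isHomogeneous_spectralProj hG k t z, smul_comm]

lemma exists_circle_pow_eq_one {k : ℕ} (hk : 1 < k) : ∃ z : Circle, z ^ k = 1 ∧ z ≠ 1 := by
  have h := Complex.isPrimitiveRoot_exp k (by omega)
  set ζ := Complex.exp (2 * Real.pi * Complex.I / k)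
  have hn : ζ ∈ Submonoid.unitSphere ℂ := by
    exact mem_sphere_zero_iff_norm.2 (h.norm'_eq_one (by omega))
  refine ⟨⟨ζ, hn⟩, Subtype.ext h.pow_eq_one, fun h1 => h.ne_one hk ?_⟩
  exact congrArg Subtype.val h1

/-- If the core has trivial center, automorphisms that preserve the core commute with the gauge
action. -/
lemma isHomogeneous_apply_of_mem_autPreserving (hG : G.NoSinks) (hsource : G.NoSources)
    (hexit : G.EveryLoopHasExit) (hcenter : Subalgebra.center ℂ (core G) = ⊥)
    {α : GraphAlg G ≃⋆ₐ[ℂ] GraphAlg G} (hα : α ∈ autPreserving (core G)) (e : E) :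
    IsHomogeneous G 1 (α (SE G e)) := by
  have : Nonempty V := ⟨G.s e⟩
  have : Nontrivial (GraphAlg G) := nontrivial_of_ne _ _ (PV_ne_zero hG (G.s e))
  choose c hc using hsource
  have hu := star_choiceIsometry_mul_self hc
  have hu1 := isHomogeneous_choiceIsometry (G := G) c
  have hu' := choiceIsometry_mul_star_ne_one hG hexit c
  set u := choiceIsometry G c
  obtain ⟨k, hk⟩ := exists_isHomogeneous_apply hG hexit hcenter hα hu hu1
  have hpos : 0 < k := by
    refine degree_pos_of_isometry hG hu hu1 ?_ ?_ hk
    · rw [← map_star, ← map_mul, hu, map_one]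
    · rw [← map_star, ← map_mul]
      exact fun h => hu' (α.injective (h.trans (map_one α).symm))
  -- Writing `S_e = (S_e u^*) u` with `S_e u^*` in the core transfers the degree of `α u` to all
  -- generators.
  have hkS (e : E) : IsHomogeneous G k (α (SE G e)) := by
    have h1 : SE G e * star u ∈ core G := by
      rw [mem_core_iff]
      simpa using (isHomogeneous_SE e).mul hu1.adjoint
    have h2 : α (SE G e) = α (SE G e * star u) * α u := by
      rw [← map_mul, mul_assoc, hu, mul_one]
    rw [h2]
    simpa using (mem_core_iff.1 (apply_mem_core hα h1)).mul hk
  obtain ⟨n, rfl⟩ : ∃ n : ℕ, k = n := ⟨k.toNat, by omega⟩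
  obtain rfl | hn : n = 1 ∨ 1 < n := by omega
  · exact hkS e
  -- The gauge map at this root of unity fixes the image of `α`, which is everything, although it
  -- multiplies `u` by `z ≠ 1`.
  obtain ⟨z, hz, hz1⟩ := exists_circle_pow_eq_one hn
  have h1 (x : GraphAlg G) : gauge G z (α x) = α x := by
    refine starAlgHom_eq_of_SE hG ((gauge G z).comp (α : GraphAlg G →⋆ₐ[ℂ] GraphAlg G))
      (α : GraphAlg G →⋆ₐ[ℂ] GraphAlg G) (fun e => ?_) x
    have := hkS e z
    rw [zpow_natCast, hz] at this
    simpa using this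
  have h2 := h1 (α.symm u)
  rw [StarAlgEquiv.apply_symm_apply, hu1 z, zpow_one] at h2
  have h3 : ((z : ℂ) - 1) • (1 : GraphAlg G) = 0 := by
    calc ((z : ℂ) - 1) • (1 : GraphAlg G) = star u * ((z : ℂ) • u - u) := by
          rw [mul_sub, mul_smul_comm, hu, sub_smul, one_smul]
      _ = 0 := by rw [h2, sub_self, mul_zero]
  rcases smul_eq_zero.1 h3 with h4 | h4
  · exact absurd (Subtype.ext (sub_eq_zero.1 h4)) hz1
  · exact absurd h4 one_ne_zero

/-! ## The shift on the diagonal -/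

/-- The restriction of the shift to the diagonal, as a `*`-homomorphism. -/
def diagShiftHom (hG : G.NoSinks) : diag G →⋆ₐ[ℂ] diag G where
  toFun := diagShift G
  map_one' := Subtype.ext <| by
    change shift G 1 = 1
    simp only [shift, mul_one]
    exact sum_SE_mul_star hG
  map_mul' x y := Subtype.ext (shift_mul _ _ (commute_PV_of_mem_diag x.2))
  map_zero' := Subtype.ext <| by
    change shift G 0 = 0
    simp [shift]
  map_add' x y := Subtype.ext (shift_add _ _)
  commutes' c := Subtype.ext <| by
    change shift G (algebraMap ℂ (GraphAlg G) c) = algebraMap ℂ (GraphAlg G) c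
    simp only [shift, ← Algebra.commutes c, mul_assoc, ← Finset.mul_sum]
    rw [sum_SE_mul_star hG, mul_one]
  map_star' x := Subtype.ext (shift_star _)

lemma coe_iterate_diagShift (m : ℕ) (x : diag G) :
    (((diagShift G)^[m] x : diag G) : GraphAlg G) = (shift G)^[m] x := by
  induction m with
  | zero => rfl
  | succ m ih => rw [Function.iterate_succ_apply', Function.iterate_succ_apply', ← ih]; rfl

lemma diagShiftHom_pow_apply (hG : G.NoSinks) (m : ℕ) (x : diag G) :
    (diagShiftHom hG ^ m) x = (diagShift G)^[m] x := by
  induction m with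
  | zero => rfl
  | succ m ih => rw [pow_succ', Function.iterate_succ_apply', ← ih]; rfl

lemma pathProjection_mul_self {p : GraphAlg G} (hp : p ∈ pathProjections G) : p * p = p := by
  rcases hp with ⟨v, rfl⟩ | ⟨μ, hμ, hp, rfl⟩
  · exact PV_mul_self v
  · rw [← mul_assoc, SPath_mul_star_mul_SPath hp hμ]

/-- Two `*`-endomorphisms of the diagonal that agree on the path projections are equal. -/
lemma diag_starAlgHom_ext {φ ψ : diag G →⋆ₐ[ℂ] diag G} (hφ : Continuous φ) (hψ : Continuous ψ)
    (h : ∀ p (hp : p ∈ pathProjections G),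
      φ ⟨p, pathProjections_subset hp⟩ = ψ ⟨p, pathProjections_subset hp⟩) : φ = ψ := by
  refine StarAlgHom.ext_topologicalClosure hφ hψ (StarAlgHom.ext_adjoin fun p hp => ?_)
  exact h p hp

/-- For commuting projections `(p - q) ^ 2` is again a projection, so its norm is `0` or at least
`1`. -/
lemma eq_of_norm_sub_lt_one {A : Type*} [CStarAlgebra A] {p q : A} (hps : star p = p)
    (hqs : star q = q) (hp : p * p = p) (hq : q * q = q) (hc : p * q = q * p)
    (h : ‖p - q‖ < 1) : p = q := by
  have hd : star (p - q) = p - q := by rw [star_sub, hps, hqs]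
  have h2 : (p - q) * (p - q) = p - p * q - p * q + q := by
    rw [mul_sub, sub_mul, sub_mul, hp, hq, hc]; abel
  have h4 : (p - q) * (p - q) * ((p - q) * (p - q)) = (p - q) * (p - q) := by
    have h5 : p * (p * q) = p * q := by rw [← mul_assoc, hp]
    have h6 : p * q * q = p * q := by rw [mul_assoc, hq]
    have h7 : p * q * p = p * q := by rw [mul_assoc, ← hc, h5]
    have h8 : q * (p * q) = p * q := by rw [← mul_assoc, ← hc, h6]
    have h9 : p * q * (p * q) = p * q := by rw [← mul_assoc, h7, h6]
    rw [h2]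
    simp only [mul_sub, sub_mul, mul_add, add_mul, hp, hq, h5, h6, h7, h8, h9, ← hc]
    abel
  have hn := CStarRing.norm_star_mul_self (x := p - q)
  rw [hd] at hn
  have hn2 := CStarRing.norm_star_mul_self (x := (p - q) * (p - q))
  rw [star_mul, hd, h4, hn] at hn2
  have h0 : ‖p - q‖ = 0 := by
    by_contra hne
    have hpos : 0 < ‖p - q‖ := lt_of_le_of_ne (norm_nonneg _) (Ne.symm hne)
    have : ‖p - q‖ * ‖p - q‖ < 1 := by nlinarith
    nlinarith [mul_pos hpos hpos]
  exact sub_eq_zero.1 (norm_eq_zero.1 h0)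

/-! ## Restrictions to the diagonal -/

/-- If `x` commutes with an element close to `α⁻¹ w`, then `w` almost commutes with `α x`. -/
lemma norm_commutator_le {w x a : GraphAlg G} {α : GraphAlg G ≃⋆ₐ[ℂ] GraphAlg G} {ε : ℝ}
    (hx : ‖x‖ ≤ 1) (ha : x * a = a * x) (hw : ‖α.symm w - a‖ ≤ ε) :
    ‖w * α x - α x * w‖ ≤ 2 * ε := by
  set b := α.symm w
  have h1 : w * α x - α x * w = α ((b - a) * x - x * (b - a)) := by
    have : w = α b := (α.apply_symm_apply w).symm
    rw [this, ← map_mul, ← map_mul, ← map_sub]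
    congr 1
    rw [sub_mul, mul_sub, ha]
    abel
  rw [h1]
  calc ‖α ((b - a) * x - x * (b - a))‖ ≤ ‖(b - a) * x - x * (b - a)‖ :=
        NonUnitalStarAlgHom.norm_apply_le (α : GraphAlg G →⋆ₐ[ℂ] GraphAlg G) _
    _ ≤ ‖(b - a) * x‖ + ‖x * (b - a)‖ := norm_sub_le _ _
    _ ≤ ‖b - a‖ * ‖x‖ + ‖x‖ * ‖b - a‖ := add_le_add (norm_mul_le _ _) (norm_mul_le _ _)
    _ ≤ ε * 1 + 1 * ε := by
        have : 0 ≤ ε := (norm_nonneg _).trans hw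
        gcongr
    _ = 2 * ε := by ring

lemma eventuallyCommutes_restrictDiag (hG : G.NoSinks) (hsource : G.NoSources)
    {α : GraphAlg G ≃⋆ₐ[ℂ] GraphAlg G} (hα : α ∈ autDiagCore G)
    (hh : ∀ e, IsHomogeneous G 1 (α (SE G e))) :
    EventuallyCommutes (restrictDiag G ⟨α, hα⟩) := by
  choose c hc using hsource
  have hu := star_choiceIsometry_mul_self hc
  have hshift {x : GraphAlg G} (hx : x ∈ diag G) :=
    star_choiceIsometry_mul_shift c (commute_PV_of_mem_diag hx)
  have hαu : IsHomogeneous G 1 (α (choiceIsometry G c)) := by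
    rw [choiceIsometry, map_sum]
    exact IsHomogeneous.sum fun v _ => hh _
  set u := choiceIsometry G c
  set w : E → GraphAlg G := fun f => SE G f * star (α u) with hwdef
  have hwcore (f : E) : w f ∈ core G := by
    rw [mem_core_iff]
    simpa using (isHomogeneous_SE f).mul hαu.adjoint
  have hsum : ∑ f, w f * star (w f) = 1 := by
    rw [← sum_SE_mul_star hG]
    refine Finset.sum_congr rfl fun f _ => ?_
    rw [hwdef]
    simp only [star_mul, star_star]
    rw [mul_assoc, ← mul_assoc (star (α u)), ← map_star, ← map_mul, hu, map_one, one_mul]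
  set K := ∑ f, ‖star (w f)‖
  have hK : 0 ≤ K := Finset.sum_nonneg fun f _ => norm_nonneg _
  -- Each commutator costs `2 * ε`, weighted by `‖star (w f)‖`; this choice makes the total `K / (K
  -- + 1) < 1`.
  have hε : 0 < (2 * (K + 1))⁻¹ := by positivity
  choose m a ha hwa using fun f => exists_homSpace_of_mem_core hG
    (symm_apply_mem_core hα.2 (hwcore f)) hε
  set M := Finset.univ.sup m
  -- Level `M + 1` is the relevant one, because the element to be commuted is `φ(φ^M p)`.
  have haM (f : E) : a f ∈ homSpace G 0 (M + 1) :=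
    homSpace_mono hG 0 ((Finset.le_sup (Finset.mem_univ f)).trans (Nat.le_succ M)) (ha f)
  set β := restrictDiag G ⟨α, hα⟩
  have hβ (x : diag G) : ((β x : diag G) : GraphAlg G) = α x := rfl
  let Φ := diagShiftHom hG
  have hΦ (x : diag G) : ((Φ x : diag G) : GraphAlg G) = shift G x := rfl
  let B : diag G →⋆ₐ[ℂ] diag G := β
  have hcontΦ : Continuous Φ := by
    refine Continuous.subtype_mk ?_ _
    exact continuous_shift.comp continuous_subtype_val
  have hcontB : Continuous B := by
    refine Continuous.subtype_mk ?_ _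
    exact (continuous_starAlgHom (α : GraphAlg G →⋆ₐ[ℂ] GraphAlg G)).comp continuous_subtype_val
  have hcontM : Continuous (Φ ^ M : diag G →⋆ₐ[ℂ] diag G) := by
    have : ⇑(Φ ^ M) = Φ^[M] := funext fun x => diagShiftHom_pow_apply hG M x
    rw [this]
    exact hcontΦ.iterate M
  -- Since `M` was fixed beforehand, the equality need only be tested on path projections, whose
  -- images are commuting projections.
  have key : (B.comp (Φ ^ M)).comp Φ = Φ.comp (B.comp (Φ ^ M)) := by
    refine diag_starAlgHom_ext ((hcontB.comp hcontM).comp hcontΦ)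
      (hcontΦ.comp (hcontB.comp hcontM)) fun p hp => ?_
    set p' : diag G := ⟨p, pathProjections_subset hp⟩
    have hp's : star p' = p' := Subtype.ext (star_pathProjection hp)
    have hp'p : p' * p' = p' := Subtype.ext (pathProjection_mul_self hp)
    have hproj (φ : diag G →⋆ₐ[ℂ] diag G) : star (φ p' : GraphAlg G) = φ p' ∧
        (φ p' : GraphAlg G) * φ p' = φ p' :=
      ⟨congrArg Subtype.val ((map_star φ p').symm.trans (congrArg φ hp's)),
        congrArg Subtype.val ((map_mul φ p' p').symm.trans (congrArg φ hp'p))⟩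
    refine Subtype.ext (eq_of_norm_sub_lt_one (hproj _).1 (hproj _).1 (hproj _).2 (hproj _).2
      (commute_of_mem_diag (Subtype.prop _) (Subtype.prop _)) ?_)
    set x : diag G := (Φ ^ M) p' with hx
    have e1 : (((B.comp (Φ ^ M)).comp Φ) p' : GraphAlg G) = α (shift G x) := by
      have : (Φ ^ M) (Φ p') = Φ x := by
        rw [hx]
        change (Φ ^ M * Φ) p' = (Φ * Φ ^ M) p'
        rw [← pow_succ, ← pow_succ']
      change ((β ((Φ ^ M) (Φ p')) : diag G) : GraphAlg G) = _
      rw [this, hβ, hΦ]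
    have e2 : ((Φ.comp (B.comp (Φ ^ M))) p' : GraphAlg G) = shift G (α x) := rfl
    have hq : ‖shift G (x : GraphAlg G)‖ ≤ 1 :=
      norm_le_one_of_projection (hproj (Φ * Φ ^ M)).1 (hproj (Φ * Φ ^ M)).2
    have hxit : shift G (x : GraphAlg G) = (shift G)^[M + 1] p := by
      rw [Function.iterate_succ_apply', hx, diagShiftHom_pow_apply, coe_iterate_diagShift]
    have hcomm (f : E) : ‖w f * α (shift G x) - α (shift G x) * w f‖ ≤ 2 * (2 * (K + 1))⁻¹ := by
      refine norm_commutator_le hq ?_ (hwa f).le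
      rw [hxit]
      exact iterate_shift_commute (pathProjections_subset hp) (haM f)
    have hαx : α (x : GraphAlg G) ∈ diag G := (β x).2
    -- Both sides equal `S_f α(x) α(u)^*`, by the intertwining relations of `S_f` and of `u^*` with
    -- the shift.
    have hinter (f : E) : shift G (α x) * w f = w f * α (shift G x) := by
      rw [hwdef]
      simp only
      rw [← mul_assoc, shift_mul_SE (commute_PV_of_mem_diag hαx), mul_assoc, mul_assoc,
        ← map_star, ← map_mul, ← map_mul, hshift x.2]
    rw [e1, e2]
    -- Since the `w f * star (w f)` sum to one, the difference is assembled from the almost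
    -- vanishing commutators.
    have hd : α (shift G x) - shift G (α x) =
        -∑ f, (w f * α (shift G x) - α (shift G x) * w f) * star (w f) := by
      simp_rw [← hinter, ← sub_mul, mul_assoc, ← Finset.mul_sum, hsum, mul_one]
      abel
    rw [hd, norm_neg]
    calc ‖∑ f, (w f * α (shift G x) - α (shift G x) * w f) * star (w f)‖
        ≤ ∑ f, 2 * (2 * (K + 1))⁻¹ * ‖star (w f)‖ := by
          refine norm_sum_le_of_le _ fun f _ => (norm_mul_le _ _).trans ?_
          gcongr
          exact hcomm f
      _ = K / (K + 1) := by
          rw [← Finset.mul_sum]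
          field_simp
          rfl
      _ < 1 := by rw [div_lt_one (by positivity)]; linarith
  refine ⟨M, fun x => ?_⟩
  have h1 := congrArg (fun φ => φ x) key
  change β ((Φ ^ M) (diagShift G x)) = diagShift G (β ((Φ ^ M) x)) at h1
  rw [diagShiftHom_pow_apply, diagShiftHom_pow_apply] at h1
  exact h1

end GraphCStar

end

/-! ### The restriction homomorphism and the restricted Weyl group -/

theorem theorem4p13 {V : Type*} {E : Type*} [Fintype V] [Fintype E]
    (G : GraphCStar.DirectedGraph V E) (hsink : G.NoSinks) (hsource : G.NoSources)
    (hexit : G.EveryLoopHasExit)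
    (hcenter : Subalgebra.center ℂ (GraphCStar.core G) = ⊥) :
    (∀ α : GraphCStar.autDiagCore G,
      GraphCStar.restrictDiag G α ∈ GraphCStar.eventualGroup G) ∧
    ∃ Res : GraphCStar.autDiagCore G →* GraphCStar.eventualGroup G,
      (∀ (α : GraphCStar.autDiagCore G) (x : GraphCStar.diag G),
        (((Res α : GraphCStar.diag G ≃⋆ₐ[ℂ] GraphCStar.diag G) x : GraphCStar.diag G) :
          GraphCStar.GraphAlg G) = (α : GraphCStar.GraphAlg G ≃⋆ₐ[ℂ] GraphCStar.GraphAlg G) x) ∧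
      Res.ker.map (GraphCStar.autDiagCore G).subtype =
        GraphCStar.autFixing (GraphCStar.diag G) ∧
      ∃ ι : GraphCStar.RestrictedWeylGroup G →* GraphCStar.eventualGroup G,
        Function.Injective ι ∧
        ∀ α : GraphCStar.autDiagCore G, ι (QuotientGroup.mk α) = Res α := by
  have hev (α : GraphCStar.autDiagCore G) :
      GraphCStar.EventuallyCommutes (GraphCStar.restrictDiag G α) :=
    GraphCStar.eventuallyCommutes_restrictDiag hsink hsource α.2
      (GraphCStar.isHomogeneous_apply_of_mem_autPreserving hsink hsource hexit hcenter α.2.2)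
  have hmem (α : GraphCStar.autDiagCore G) :
      GraphCStar.restrictDiag G α ∈ GraphCStar.eventualGroup G :=
    -- The condition on the inverse is free, as `α⁻¹` also preserves core and diagonal.
    ⟨hev α, by rw [← map_inv]; exact hev α⁻¹⟩
  let Res : GraphCStar.autDiagCore G →* GraphCStar.eventualGroup G :=
    (GraphCStar.restrictDiag G).codRestrict _ hmem
  have hRes (α : GraphCStar.autDiagCore G) (x : GraphCStar.diag G) :
      (((Res α : GraphCStar.diag G ≃⋆ₐ[ℂ] GraphCStar.diag G) x : GraphCStar.diag G) :
        GraphCStar.GraphAlg G) =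
          (α : GraphCStar.GraphAlg G ≃⋆ₐ[ℂ] GraphCStar.GraphAlg G) x := rfl
  have hker : Res.ker = (GraphCStar.autFixing (GraphCStar.diag G)).subgroupOf
      (GraphCStar.autDiagCore G) := by
    ext α
    rw [MonoidHom.mem_ker, Subgroup.mem_subgroupOf]
    constructor
    · intro h x hx
      have h1 := hRes α ⟨x, hx⟩
      rw [h] at h1
      exact h1.symm
    · intro h
      refine Subtype.ext (StarAlgEquiv.ext fun x => Subtype.ext ?_)
      rw [hRes]
      exact h x x.2
  refine ⟨hmem, Res, hRes, ?_, ?_⟩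
  · rw [hker, Subgroup.subgroupOf_map_subtype, inf_eq_left]
    exact GraphCStar.autFixing_le_autDiagCore hsink hexit
  · refine ⟨QuotientGroup.lift _ Res fun α hα => ?_, ?_, fun α => rfl⟩
    · rw [← hker] at hα
      exact hα
    · rw [injective_iff_map_eq_one]
      intro q hq
      obtain ⟨α, rfl⟩ := QuotientGroup.mk_surjective q
      rw [QuotientGroup.eq_one_iff, ← hker]
      exact hq
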